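/- Let $X$ be a finite quandle, and let $L$ be an (oriented) $1$-linkoid of link type, i.e. a $1$-linkoid (one open component and finitely many closed components, considered up to Reidemeister moves away from the endpoints) which has a diagram on the sphere whose two endpoints, the leg and the head, lie in the same region. Let $L_-$ be the under-closure of $L$, that is, the link obtained by leading the head, below every strand it meets, into the region of the leg and joining the two endpoints there. Let $Q(\cdot)$ denote the fundamental quandle, generated by the arcs of a diagram with one relation for each crossing, and let $l,h\in Q(L)$ be the generators belonging to the arcs at the leg and at the head. The quandle counting invariant of a linkoid or link $M$ is $\Phi_X^{\mathbb Z}(M)=|\mathrm{Hom}(Q(M),X)|$, and the quandle counting matrix $\Phi_X^{M}(L)$ of $L$ is the matrix indexed by $X\times X$ whose $(i,j)$ entry is the number of quandle homomorphisms $\varphi\colon Q(L)\to X$ with $\varphi(l)=i$ and $\varphi(h)=j$. Then: 1. $\operatorname{tr}\Phi_X^{M}(L)=\Phi_X^{\mathbb Z}(L_-)$. 2. If $X$ is faithful (distinct elements $y$ of $X$ give distinct permutations $x\mapsto x\triangleleft y$ of $X$), then $\Phi_X^{M}(L)_{i,j}=0$ for all $i\neq j$ in $X$. 3. If $X$ is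 faithful, then $\Phi_X^{\mathbb Z}(L)=\Phi_X^{\mathbb Z}(L_-)$. These equalities hold for every diagram representing $L$ and every diagram representing $L_-$. -/

import Mathlib

namespace Linkoid

open scoped Quandles

universe u v

/-! ### Quandles given by generators and relations

Mathlib writes the quandle operation as a left action: `y ◃ x` is the element obtained from `x` by
applying the bijection attached to `y`, often written `x ◁ y` in the knot theory literature. -/

/-- Formal expressions in the quandle operation and its inverse. -/
inductive QTerm (A : Type u) : Type u
  | of (a : A) : QTerm A
  | act (x y : QTerm A) : QTerm A
  | invAct (x y : QTerm A) : QTerm A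

/-- The smallest congruence that contains `r` and forces the quandle axioms. -/
inductive QRel {A : Type u} (r : QTerm A → QTerm A → Prop) : QTerm A → QTerm A → Prop
  | rel {x y} : r x y → QRel r x y
  | refl (x) : QRel r x x
  | symm {x y} : QRel r x y → QRel r y x
  | trans {x y z} : QRel r x y → QRel r y z → QRel r x z
  | act_congr {x x' y y'} : QRel r x x' → QRel r y y' → QRel r (.act x y) (.act x' y')
  | invAct_congr {x x' y y'} : QRel r x x' → QRel r y y' → QRel r (.invAct x y) (.invAct x' y')
  | self_distrib (x y z) : QRel r (.act x (.act y z)) (.act (.act x y) (.act x z))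
  | left_inv (x y) : QRel r (.invAct x (.act x y)) y
  | right_inv (x y) : QRel r (.act x (.invAct x y)) y
  | fix (x) : QRel r (.act x x) x

/-- The setoid of `QRel r`. -/
def qSetoid {A : Type u} (r : QTerm A → QTerm A → Prop) : Setoid (QTerm A) where
  r := QRel r
  iseqv := ⟨QRel.refl, QRel.symm, QRel.trans⟩

/-- The quandle with generators `A` and relations `r`. -/
def PresentedQuandle {A : Type u} (r : QTerm A → QTerm A → Prop) : Type u :=
  Quotient (qSetoid r)

/-- The class of a formal expression. -/
def PresentedQuandle.mk {A : Type u} (r : QTerm A → QTerm A → Prop) (x : QTerm A) :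
    PresentedQuandle r :=
  Quotient.mk (qSetoid r) x

instance {A : Type u} (r : QTerm A → QTerm A → Prop) : Quandle (PresentedQuandle r) where
  act := Quotient.map₂ QTerm.act fun _ _ h _ _ h' => QRel.act_congr h h'
  invAct := Quotient.map₂ QTerm.invAct fun _ _ h _ _ h' => QRel.invAct_congr h h'
  self_distrib := by
    rintro ⟨x⟩ ⟨y⟩ ⟨z⟩
    exact Quotient.sound (QRel.self_distrib x y z)
  left_inv := by
    rintro ⟨x⟩ ⟨y⟩
    exact Quotient.sound (QRel.left_inv x y)
  right_inv := by
    rintro ⟨x⟩ ⟨y⟩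
    exact Quotient.sound (QRel.right_inv x y)
  fix := by
    rintro ⟨x⟩
    exact Quotient.sound (QRel.fix x)

/-- A quandle is faithful if distinct elements act by distinct permutations. -/
def IsFaithful (X : Type u) [Quandle X] : Prop :=
  Function.Injective (Rack.act' : X → X ≃ X)

/-- An `m`-pointed quandle. -/
structure PointedQuandle (m : ℕ) where
  carrier : Type u
  [quandle : Quandle carrier]
  base : Fin m → carrier

attribute [instance] PointedQuandle.quandle

/-- Homomorphisms of pointed quandles: quandle homomorphisms that match the basepoints. -/
def PointedQuandle.Hom {m : ℕ} (P : PointedQuandle.{u} m) (Q : PointedQuandle.{v} m) :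
    Type (max u v) :=
  {f : P.carrier →◃ Q.carrier // ∀ i, f (P.base i) = Q.base i}

/-! ### Linkoid diagrams -/

/-- The points of a diagram at which its strands are cut into edges: each crossing `c` is met once
on its over-strand (`over c`) and once on its under-strand (`under c`); `pt m` is an auxiliary point
in the interior of an edge or on a circle without crossings; `inf i` stands for the two
endpoints of the `i`-th open component (it is entered at the head and left at the leg). -/
inductive Node (n : ℕ) (C M : Type) : Type
  | over (c : C) : Node n C M
  | under (c : C) : Node n C M
  | pt (m : M) : Node n C M
  | inf (i : Fin n) : Node n C M

/-- Relabelling of crossings and auxiliary points. -/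
def Node.map {n : ℕ} {C M C' M' : Type} (f : C → C') (g : M → M') : Node n C M → Node n C' M'
  | .over c => .over (f c)
  | .under c => .under (f c)
  | .pt m => .pt (g m)
  | .inf i => .inf i

/-- Oriented signed Gauss diagrams with `n` ordered open components and any finite number of
closed ones. Travelling along the orientation, the node after `x` is `next x`; the edge from `x` to
`next x` is named by `x`. So the edge at the leg of component `i` is `inf i`, and the edge
at its head is `next.symm (inf i)`. The cycles of `next` are the components, and each contains
at most one node `inf i`. -/
structure GaussDiagram (n : ℕ) where
  Crossing : Type
  Point : Type
  [finite_crossing : Finite Crossing]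
  [finite_point : Finite Point]
  next : Equiv.Perm (Node n Crossing Point)
  /-- `true` for a positive crossing, `false` for a negative one. -/
  positive : Crossing → Bool
  sep : ∀ i j, next.SameCycle (.inf i) (.inf j) → i = j

attribute [instance] GaussDiagram.finite_crossing GaussDiagram.finite_point

namespace GaussDiagram

variable {n : ℕ} (D : GaussDiagram n)

/-- The nodes, which are also the names of the edges. -/
abbrev Nodes : Type := Node n D.Crossing D.Point

/-- The underlying graph on the surface is described as a rotation system. A dart `(x, true)` is the
start of the edge that leaves `x`, a dart `(x, false)` is the end of the edge that enters `x`. -/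
abbrev Dart : Type := D.Nodes × Bool

/-- The involution that exchanges the two darts of an edge. -/
def flip : Equiv.Perm D.Dart where
  toFun
    | (x, true) => (D.next x, false)
    | (x, false) => (D.next.symm x, true)
  invFun
    | (x, true) => (D.next x, false)
    | (x, false) => (D.next.symm x, true)
  left_inv := by rintro ⟨x, _ | _⟩ <;> simp
  right_inv := by rintro ⟨x, _ | _⟩ <;> simp

/-- The counterclockwise rotation of the darts around each vertex. At a positive crossing the
cyclic order is over-out, under-out, over-in, under-in; at a negative crossing it is over-out,
under-in, over-in, under-out. An auxiliary point is a vertex of valence two, and the two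
endpoints of an open component are two vertices of valence one. -/
def rot : Equiv.Perm D.Dart where
  toFun
    | (.over c, b) => (.under c, b == D.positive c)
    | (.under c, b) => (.over c, b != D.positive c)
    | (.pt m, b) => (.pt m, !b)
    | (.inf i, b) => (.inf i, b)
  invFun
    | (.over c, b) => (.under c, b != D.positive c)
    | (.under c, b) => (.over c, b == D.positive c)
    | (.pt m, b) => (.pt m, !b)
    | (.inf i, b) => (.inf i, b)
  left_inv := by
    rintro ⟨c | c | m | i, b⟩
    · cases b <;> cases h : D.positive c <;> simp [h]
    · cases b <;> cases h : D.positive c <;> simp [h]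
    · simp
    · simp
  right_inv := by
    rintro ⟨c | c | m | i, b⟩
    · cases b <;> cases h : D.positive c <;> simp [h]
    · cases b <;> cases h : D.positive c <;> simp [h]
    · simp
    · simp

/-- The permutation whose cycles are the boundaries of the regions: traverse an edge, then turn to
the neighbouring dart. -/
def face : Equiv.Perm D.Dart := D.rot * D.flip

/-- Number of vertices of the underlying graph. -/
noncomputable def numVertices : ℕ := Nat.card (Quotient (Equiv.Perm.SameCycle.setoid D.rot))

/-- Number of edges. -/
noncomputable def numEdges : ℕ := Nat.card D.Nodes

/-- Number of faces. -/
noncomputable def numFaces : ℕ := Nat.card (Quotient (Equiv.Perm.SameCycle.setoid D.face))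

/-- Number of connected components of the underlying graph. -/
noncomputable def numPieces : ℕ :=
  Nat.card (MulAction.orbitRel.Quotient (Subgroup.closure {D.rot, D.flip}) D.Dart)

/-- Every connected component of the underlying graph, with its rotation system, lies on a sphere.
By Euler's inequality for each component this is the equation `V - E + F = 2 k`, with `k` the
number of components. -/
def IsPlanar : Prop := D.numVertices + D.numFaces = D.numEdges + 2 * D.numPieces

end GaussDiagram

/-- Diagrams on the sphere of ordered oriented `n`-linkoids, up to isotopy of the sphere and up
to the placement of the connected components of the diagram in each other's regions. For `n = 0`
these are link diagrams. -/
structure Diagram (n : ℕ) extends GaussDiagram n where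
  planar : toGaussDiagram.IsPlanar

namespace Diagram

variable {n : ℕ}

/-! ### The fundamental quandle and the counting invariants -/

/-- Two consecutive edges belong to the same arc if they do not meet at an under-crossing or at
an endpoint. -/
inductive ArcStep (D : Diagram n) : D.Nodes → D.Nodes → Prop
  | over (c : D.Crossing) : ArcStep D (D.next.symm (.over c)) (.over c)
  | pt (m : D.Point) : ArcStep D (D.next.symm (.pt m)) (.pt m)

/-- The arcs of a diagram. -/
def Arc (D : Diagram n) : Type := Quot D.ArcStep

/-- The arc that contains the edge `x`. -/
def arc (D : Diagram n) (x : D.Nodes) : D.Arc := Quot.mk _ x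

/-- The crossing relations. At a positive crossing the under-strand passes from the right to the left
of the over-strand, at a negative crossing from the left to the right; in both cases the arc
on the left is the image of the arc on the right under the action of the over-arc. -/
inductive Relator (D : Diagram n) : QTerm D.Arc → QTerm D.Arc → Prop
  | pos (c : D.Crossing) (h : D.positive c = true) :
      Relator D (.of (D.arc (.under c)))
        (.act (.of (D.arc (.over c))) (.of (D.arc (D.next.symm (.under c)))))
  | neg (c : D.Crossing) (h : D.positive c = false) :
      Relator D (.of (D.arc (D.next.symm (.under c))))
        (.act (.of (D.arc (.over c))) (.of (D.arc (.under c))))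

/-- The fundamental quandle `Q(D)`. -/
abbrev FundamentalQuandle (D : Diagram n) : Type := PresentedQuandle D.Relator

/-- The generator given by the arc at the leg of the `i`-th open component. -/
def leg (D : Diagram n) (i : Fin n) : D.FundamentalQuandle :=
  PresentedQuandle.mk _ (.of (D.arc (.inf i)))

/-- The generator given by the arc at the head of the `i`-th open component. -/
def head (D : Diagram n) (i : Fin n) : D.FundamentalQuandle :=
  PresentedQuandle.mk _ (.of (D.arc (D.next.symm (.inf i))))

/-- The fundamental pointed quandle `P(D) = (Q(D), l₁, h₁, …, lₙ, hₙ)`. -/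
def fundamentalPointedQuandle (D : Diagram n) : PointedQuandle (2 * n) where
  carrier := D.FundamentalQuandle
  base k :=
    if k.val % 2 = 0 then D.leg ⟨k.val / 2, by omega⟩ else D.head ⟨k.val / 2, by omega⟩

/-- The quandle counting invariant: the number of homomorphisms `Q(D) → X`. -/
noncomputable def quandleCount (D : Diagram n) (X : Type u) [Quandle X] : ℕ :=
  Nat.card (D.FundamentalQuandle →◃ X)

/-- The pointed quandle counting invariant: the number of pointed homomorphisms `P(D) → P`. -/
noncomputable def pointedCount (D : Diagram n) (P : PointedQuandle.{u} (2 * n)) : ℕ :=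
  Nat.card (D.fundamentalPointedQuandle.Hom P)

/-- The quandle counting matrix of a 1-linkoid diagram. Its rows are indexed by the colour of the
leg and its columns by the colour of the head. -/
noncomputable def countingMatrix (D : Diagram 1) (X : Type u) [Quandle X] : Matrix X X ℕ :=
  Matrix.of fun i j => D.pointedCount { carrier := X, base := ![i, j] }

/-! ### Reidemeister moves -/

open Classical in
/-- The list `l` at the edge `x`, and nothing at the other edges. -/
noncomputable def insertAt {A B : Type} (x : A) (l : List B) : A → List B :=
  fun y => if y = x then l else []

/-- `D'` arises from `D` by inserting, for every edge `x` of `D`, the nodes of the list `ins x` in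
this order into that edge; `f` and `g` tell which crossings and points of `D'` are the old
ones. -/
structure Expands (D D' : Diagram n) (f : D.Crossing → D'.Crossing) (g : D.Point → D'.Point)
    (ins : D.Nodes → List D'.Nodes) : Prop where
  f_inj : Function.Injective f
  g_inj : Function.Injective g
  positive_eq : ∀ c, D'.positive (f c) = D.positive c
  chain : ∀ x, List.IsChain (fun a b => D'.next a = b)
    (Node.map f g x :: (ins x ++ [Node.map f g (D.next x)]))

/-- One of `x`, `y` directly follows the other: first `x`, then `y` if `b` is true, and the other
way round if `b` is false. -/
def Consecutive (D : Diagram n) (b : Bool) (x y : D.Nodes) : Prop :=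
  cond b (D.next x = y) (D.next y = x)

open Classical in
/-- The exchange of the two passages on each of the three strands of a Reidemeister III move with
crossings `a` (top over middle), `b` (top over bottom), `c` (middle over bottom). -/
noncomputable def triangleSwap (D : Diagram n) (a b c : D.Crossing) : Equiv.Perm D.Nodes :=
  Equiv.swap (.over a) (.over b) * Equiv.swap (.under a) (.over c) *
    Equiv.swap (.under b) (.under c)

/-- The elementary moves: relabelling, adding an auxiliary point, and the Reidemeister moves
I, II, III. All diagrams here are on the sphere, so these are the usual moves. -/
inductive Move : Diagram n → Diagram n → Prop
  /-- Relabelling. -/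
  | relabel {D D' : Diagram n} {f : D.Crossing → D'.Crossing} {g : D.Point → D'.Point}
      (hf : Function.Surjective f) (hg : Function.Surjective g)
      (h : Expands D D' f g fun _ => []) : Move D D'
  /-- Subdivision of the edge `x` by an auxiliary point `m`. -/
  | point {D D' : Diagram n} {f : D.Crossing → D'.Crossing} {g : D.Point → D'.Point}
      (x : D.Nodes) (m : D'.Point)
      (hf : Function.Surjective f) (hg : Set.range g = {m}ᶜ)
      (h : Expands D D' f g (insertAt x [.pt m])) : Move D D'
  /-- Reidemeister I: a kink with crossing `k` in the edge `x`. -/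
  | r1 {D D' : Diagram n} {f : D.Crossing → D'.Crossing} {g : D.Point → D'.Point}
      (x : D.Nodes) (k : D'.Crossing) (l : List D'.Nodes)
      (hf : Set.range f = {k}ᶜ) (hg : Function.Surjective g)
      (hl : l = [.over k, .under k] ∨ l = [.under k, .over k])
      (h : Expands D D' f g (insertAt x l)) : Move D D'
  /-- Reidemeister II: the edge `x` is pushed over the edge `y`, with crossings `k₁`, `k₂` of opposite
  signs, which are met by `y` in the same or in the opposite order. If `x = y`, the part that
  goes over may come before or after the part that goes under. -/
  | r2 {D D' : Diagram n} {f : D.Crossing → D'.Crossing} {g : D.Point → D'.Point}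
      (x y : D.Nodes) (k₁ k₂ : D'.Crossing) (l : List D'.Nodes) (ins : D.Nodes → List D'.Nodes)
      (hk : k₁ ≠ k₂) (hs : D'.positive k₁ ≠ D'.positive k₂)
      (hf : Set.range f = {k₁, k₂}ᶜ) (hg : Function.Surjective g)
      (hl : l = [.under k₁, .under k₂] ∨ l = [.under k₂, .under k₁])
      (hins : (ins = fun z => insertAt x [.over k₁, .over k₂] z ++ insertAt y l z) ∨
        (ins = fun z => insertAt y l z ++ insertAt x [.over k₁, .over k₂] z))
      (h : Expands D D' f g ins) : Move D D'
  /-- Reidemeister III at the crossings `a` (top over middle), `b` (top over bottom), `c` (middle over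
  bottom). The Booleans tell whether the top strand runs from `a` to `b`, the middle one from `a`
  to `c`, the bottom one from `b` to `c`; the conditions on signs say that the three
  segments bound a triangular region. -/
  | r3 {D D' : Diagram n} {f : D.Crossing → D'.Crossing} {g : D.Point → D'.Point}
      (a b c : D.Crossing) (top mid bot : Bool)
      (hab : a ≠ b) (hac : a ≠ c) (hbc : b ≠ c)
      (htop : D.Consecutive top (.over a) (.over b))
      (hmid : D.Consecutive mid (.under a) (.over c))
      (hbot : D.Consecutive bot (.under b) (.under c))
      (hs₁ : (D.positive a ^^ top ^^ mid) = (D.positive b ^^ top ^^ bot))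
      (hs₂ : (D.positive a ^^ top ^^ mid) = (D.positive c ^^ mid ^^ bot))
      (hf : Function.Bijective f) (hg : Function.Bijective g)
      (hpos : ∀ k, D'.positive (f k) = D.positive k)
      (h : ∀ x, D'.next (Node.map f g (D.triangleSwap a b c x)) =
        Node.map f g (D.triangleSwap a b c (D.next x))) : Move D D'

/-- Two diagrams represent the same linkoid (the same link if `n = 0`). -/
def Equivalent (D D' : Diagram n) : Prop := Relation.EqvGen Move D D'

/-! ### Link-type 1-linkoids and the under-closure -/

/-- The two endpoints of a 1-linkoid diagram lie in the same region. -/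
def EndpointsInSameRegion (D : Diagram 1) : Prop :=
  D.face.SameCycle (.inf 0, true) (.inf 0, false)

/-- The 1-linkoid represented by `D` is of link type: it has a diagram whose endpoints lie in the
same region. -/
def IsLinkType (D : Diagram 1) : Prop :=
  ∃ D₀ : Diagram 1, D.Equivalent D₀ ∧ D₀.EndpointsInSameRegion

/-- The under forbidden move: the head is moved across the edge `x`, below it, so that a new crossing
`k` arises between `x` and the end of the open component. -/
inductive UnderMove : Diagram 1 → Diagram 1 → Prop
  | mk {D D' : Diagram 1} {f : D.Crossing → D'.Crossing} {g : D.Point → D'.Point}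
      (x : D.Nodes) (k : D'.Crossing)
      (hf : Set.range f = {k}ᶜ) (hg : Function.Surjective g)
      (h : Expands D D' f g fun z =>
        insertAt x [.over k] z ++ insertAt (D.next.symm (.inf 0)) [.under k] z) :
      UnderMove D D'

/-- The node of a closed-up diagram that corresponds to a given node of a 1-linkoid diagram; the
endpoints are glued to one auxiliary point `p`. -/
def closeNode {C M C' M' : Type} (f : C → C') (g : M → M') (p : M') : Node 1 C M → Node 0 C' M'
  | .over c => .over (f c)
  | .under c => .under (f c)
  | .pt m => .pt (g m)
  | .inf _ => .pt p

/-- The endpoints of `D` lie in the same region, and the link diagram `K` arises from `D` by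
joining them with an arc inside that region. -/
def IsJoin (D : Diagram 1) (K : Diagram 0) : Prop :=
  D.EndpointsInSameRegion ∧
    ∃ (f : D.Crossing → K.Crossing) (g : D.Point → K.Point) (p : K.Point),
      Function.Bijective f ∧ Function.Injective g ∧ Set.range g = {p}ᶜ ∧
      (∀ c, K.positive (f c) = D.positive c) ∧
      ∀ x, K.next (closeNode f g p x) = closeNode f g p (D.next x)

/-- `K` represents the under-closure of the 1-linkoid represented by `D`: in some diagram of the
1-linkoid the head is led, below everything that it meets, into the region of the leg, the
endpoints are joined there, and `K` is any diagram of the resulting link. -/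
def IsUnderClosure (D : Diagram 1) (K : Diagram 0) : Prop :=
  ∃ (D₁ D₂ : Diagram 1) (K₁ : Diagram 0), D.Equivalent D₁ ∧
    Relation.ReflTransGen UnderMove D₁ D₂ ∧ D₂.IsJoin K₁ ∧ K₁.Equivalent K

end Diagram

end Linkoid

/-! Homomorphisms from the fundamental quandle to `X` are colourings of the edges of a diagram. The
trace counts the colourings with equal colours at leg and head, and so does the coloring number of a
diagram obtained by joining the endpoints inside a common region (`IsJoin.card_coloring`). The under
forbidden move, however, changes the colour of the head, so a condition is needed that survives this
move as well as the Reidemeister moves.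

This condition is `Coloring.Closes`. Colour the regions too, letting the colour of an edge act
whenever that edge is crossed. Start beside the leg with the colour of the leg, follow the open
strand, and require that the region colour reached at the head is the colour of the head. Pushing
the head below an edge applies the same permutation to both colours.

Region colours are sheets of a covering of the diagram's sphere. The crossing relations make it
unbranched at the crossings, so it branches only over the two endpoints. The sphere minus two points
has infinite cyclic fundamental group; hence every loop based at the head acts on the sheets by a
power of the head's action (`sameCycle_of_coverRel`). The combinatorial proof is an Euler
characteristic count: planarity of the diagram, with the genus inequality `card_cycles_add_le` for
the cover, leaves no room for further identifications of sheets.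

Two consequences follow. The head's colour is fixed by its own action, so the closing condition may
be tested along any path (`Coloring.closes_iff`); with both endpoints in one region the constant
path turns it into equality of leg and head. Moreover, in that situation the loops around leg and
head have the same monodromy, so leg and head act alike (`EndpointsInSameRegion.act_eq`); for
faithful `X` they are equal, and the matrix is diagonal.

Reidemeister moves preserve the colourings, the endpoint colours and the parallel transport
(`Move.corresponds`). The first claim then follows by carrying the count of closing colourings from
a join, back through the under moves, to a diagram of `D` whose endpoints share a region
(`IsUnderClosure.card_coloring`). -/

namespace Linkoid

open scoped Quandles

universe u v

/-! ### The Euler inequality for a pair of permutations -/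

section Euler

open Module Equiv

variable {T : Type*}

/-- The coboundary operator of a permutation on rational functions. -/
noncomputable def permDiff (a : Perm T) : (T → ℚ) →ₗ[ℚ] (T → ℚ) :=
  LinearMap.funLeft ℚ ℚ a - LinearMap.id

theorem permDiff_apply (a : Perm T) (f : T → ℚ) (x : T) : permDiff a f x = f (a x) - f x := rfl

/-- Functions constant on classes are functions on the quotient. This turns counts of cycles and of
orbits into dimensions. -/
theorem finrank_of_setoid [Finite T] (s : Setoid T) (W : Submodule ℚ (T → ℚ))
    (hW : ∀ f, f ∈ W ↔ ∀ x y, s x y → f x = f y) :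
    finrank ℚ W = Nat.card (Quotient s) := by
  have : Fintype (Quotient s) := Fintype.ofFinite _
  let e : W ≃ₗ[ℚ] (Quotient s → ℚ) :=
    { toFun := fun f => Quotient.lift f.1 ((hW f.1).1 f.2)
      invFun := fun g => ⟨fun x => g (Quotient.mk s x),
        (hW _).2 fun _ _ h => congrArg g (Quotient.sound h)⟩
      left_inv := fun _ => rfl
      right_inv := fun g => by
        funext q
        induction q using Quotient.inductionOn
        rfl
      map_add' := fun f g => by
        funext q
        induction q using Quotient.inductionOn
        rfl
      map_smul' := fun c f => by
        funext q
        induction q using Quotient.inductionOn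
        rfl }
  rw [e.finrank_eq, Module.finrank_pi, Nat.card_eq_fintype_card]

theorem apply_eq_of_sameCycle {S : Type*} {a : Perm T} {f : T → S} (h : ∀ x, f (a x) = f x)
    {x y : T} (hxy : a.SameCycle x y) : f x = f y := by
  obtain ⟨i, rfl⟩ := hxy
  induction i using Int.induction_on with
  | zero => rfl
  | succ i ih => rw [add_comm, zpow_add, zpow_one, Perm.mul_apply, h, ih]
  | pred i ih =>
    rw [ih, ← h ((a ^ (-(i : ℤ) - 1)) x), ← Perm.mul_apply]
    congr 2
    rw [← zpow_one_add]
    congr 1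
    ring

theorem apply_eq_of_orbit {S : Type*} {a b : Perm T} {f : T → S} (ha : ∀ x, f (a x) = f x)
    (hb : ∀ x, f (b x) = f x) {x y : T}
    (hxy : MulAction.orbitRel (Subgroup.closure {a, b}) T x y) : f x = f y := by
  obtain ⟨⟨g, hg⟩, rfl⟩ := hxy
  change f (g y) = f y
  revert y
  induction hg using Subgroup.closure_induction with
  | mem g hg =>
    intro y
    rcases hg with rfl | rfl
    · exact ha y
    · exact hb y
  | one => intro y; rfl
  | mul g g' _ _ h h' => intro y; rw [Perm.mul_apply, h, h']
  | inv g _ h => intro y; rw [← h (y := g⁻¹ y), ← Perm.mul_apply, mul_inv_cancel, Perm.one_apply]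

theorem finrank_ker_permDiff [Finite T] (a : Perm T) :
    finrank ℚ (LinearMap.ker (permDiff a)) = Nat.card (Quotient (Perm.SameCycle.setoid a)) := by
  refine finrank_of_setoid _ _ fun f => ?_
  rw [LinearMap.mem_ker]
  constructor
  · intro h x y hxy
    exact apply_eq_of_sameCycle (fun x => sub_eq_zero.1 (congrFun h x)) hxy
  · intro h
    funext x
    exact sub_eq_zero.2 (h _ _ ⟨-1, by simp⟩)

theorem orbitRel_apply_left (a b : Perm T) (x : T) :
    MulAction.orbitRel (Subgroup.closure {a, b}) T (a x) x :=
  ⟨⟨a, Subgroup.subset_closure (by simp)⟩, rfl⟩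

theorem orbitRel_apply_right (a b : Perm T) (x : T) :
    MulAction.orbitRel (Subgroup.closure {a, b}) T (b x) x :=
  ⟨⟨b, Subgroup.subset_closure (by simp)⟩, rfl⟩

/-- The Euler inequality: a pair of permutations describes a surface of nonnegative genus. -/
theorem card_cycles_add_le [Finite T] (a b : Perm T) :
    Nat.card (Quotient (Perm.SameCycle.setoid a)) + Nat.card (Quotient (Perm.SameCycle.setoid b)) +
      Nat.card (Quotient (Perm.SameCycle.setoid (a * b))) ≤
    Nat.card T + 2 * Nat.card (MulAction.orbitRel.Quotient (Subgroup.closure {a, b}) T) := by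
  classical
  have : Fintype T := Fintype.ofFinite T
  set k := Nat.card (MulAction.orbitRel.Quotient (Subgroup.closure {a, b}) T) with hk
  have hn : finrank ℚ (T → ℚ) = Nat.card T := by
    rw [Module.finrank_pi, Nat.card_eq_fintype_card]
  have ra := LinearMap.finrank_range_add_finrank_ker (permDiff a)
  have rb := LinearMap.finrank_range_add_finrank_ker (permDiff b)
  have rc := LinearMap.finrank_range_add_finrank_ker (permDiff (a * b))
  rw [finrank_ker_permDiff, hn] at ra rb rc
  set A := LinearMap.range (permDiff a)
  set B := LinearMap.range (permDiff b)
  set C := LinearMap.range (permDiff (a * b))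
  -- The identity `f ∘ ab - f = (f ∘ ab - f ∘ a) + (f ∘ a - f)` makes `β` followed by `δ` zero. The
  -- inequality is a dimension count in this short complex.
  let δ : (A × B × C) →ₗ[ℚ] (T → ℚ) :=
    A.subtype.coprod (B.subtype.coprod (-C.subtype))
  let β : (T → ℚ) →ₗ[ℚ] (A × B × C) :=
    (permDiff a).rangeRestrict.prod
      (((permDiff b).rangeRestrict ∘ₗ LinearMap.funLeft ℚ ℚ a).prod (permDiff (a * b)).rangeRestrict)
  have hβδ : LinearMap.range β ≤ LinearMap.ker δ := by
    rintro _ ⟨f, rfl⟩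
    rw [LinearMap.mem_ker]
    funext x
    change (f (a x) - f x) + ((f (a (b x)) - f (a x)) + -(f (a (b x)) - f x)) = 0
    ring
  have hβ : finrank ℚ (LinearMap.ker β) = k := by
    refine finrank_of_setoid _ _ fun f => ?_
    rw [LinearMap.mem_ker]
    constructor
    · intro h x y hxy
      have h1 : ∀ x, f (a x) = f x := fun x =>
        sub_eq_zero.1 (congrFun (congrArg (fun p => (p.1 : T → ℚ)) h) x)
      have h2 : ∀ x, f (b x) = f x := fun x => by
        have := sub_eq_zero.1 (congrFun (congrArg (fun p => (p.2.2 : T → ℚ)) h) x)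
        rw [← h1]
        exact this
      exact apply_eq_of_orbit h1 h2 hxy
    · intro h
      have h1 : ∀ x, f (a x) = f x := fun x => h _ _ (orbitRel_apply_left a b x)
      have h2 : ∀ x, f (b x) = f x := fun x => h _ _ (orbitRel_apply_right a b x)
      refine Prod.ext (Subtype.ext ?_) (Prod.ext (Subtype.ext ?_) (Subtype.ext ?_)) <;> funext x
      · exact sub_eq_zero.2 (h1 x)
      · exact sub_eq_zero.2 (show f (a (b x)) = f (a x) by rw [h1, h1, h2])
      · exact sub_eq_zero.2 (show f (a (b x)) = f x by rw [h1, h2])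
  -- Modulo the image of `δ`, indicators of points in one orbit agree, so one indicator per orbit
  -- spans the cokernel.
  have hδ : Nat.card T ≤ finrank ℚ (LinearMap.range δ) + k := by
    set W := LinearMap.range δ
    have hA : A ≤ W := fun u hu => ⟨(⟨u, hu⟩, 0, 0), by simp [δ]⟩
    have hB : B ≤ W := fun u hu => ⟨(0, ⟨u, hu⟩, 0), by simp [δ]⟩
    have hmk : ∀ x y, MulAction.orbitRel (Subgroup.closure {a, b}) T x y →
        W.mkQ (Pi.single x 1) = W.mkQ (Pi.single y 1) := by
      have key : ∀ c : Perm T, LinearMap.range (permDiff c) ≤ W →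
          ∀ x, W.mkQ (Pi.single (c x) 1) = W.mkQ (Pi.single x 1) := by
        intro c hc x
        symm
        rw [← sub_eq_zero, ← map_sub, ← LinearMap.mem_ker, Submodule.ker_mkQ]
        refine hc ⟨Pi.single (c x) 1, ?_⟩
        funext z
        simp [permDiff_apply, Pi.single_apply]
      exact fun x y h => apply_eq_of_orbit (f := fun x => W.mkQ (Pi.single x 1))
        (key a hA) (key b hB) h
    let Q := MulAction.orbitRel.Quotient (Subgroup.closure {a, b}) T
    have : Fintype Q := Fintype.ofFinite _
    let r : Q → T → ℚ := fun q => Pi.single q.out 1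
    have htop : W ⊔ Submodule.span ℚ (Set.range r) = ⊤ := by
      rw [eq_top_iff, ← (Pi.basisFun ℚ T).span_eq, Submodule.span_le]
      rintro _ ⟨x, rfl⟩
      rw [Pi.basisFun_apply]
      let q : Q := Quotient.mk _ x
      have hq := hmk x q.out ((MulAction.orbitRel _ T).symm (Quotient.mk_out x))
      rw [← sub_eq_zero, ← map_sub, ← LinearMap.mem_ker, Submodule.ker_mkQ] at hq
      rw [← sub_add_cancel (Pi.single x (1 : ℚ)) (r q)]
      exact add_mem (Submodule.mem_sup_left hq)
        (Submodule.mem_sup_right (Submodule.subset_span ⟨q, rfl⟩))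
    calc Nat.card T = finrank ℚ (T → ℚ) := hn.symm
      _ = finrank ℚ (W ⊔ Submodule.span ℚ (Set.range r) : Submodule ℚ (T → ℚ)) := by
        rw [htop, finrank_top]
      _ ≤ finrank ℚ W + finrank ℚ (Submodule.span ℚ (Set.range r)) :=
        Submodule.finrank_add_le_finrank_add_finrank _ _
      _ ≤ finrank ℚ W + k := by
        gcongr
        rw [hk, Nat.card_eq_fintype_card]
        exact finrank_range_le_card r
  have h1 := LinearMap.finrank_range_add_finrank_ker δ
  have h2 := LinearMap.finrank_range_add_finrank_ker β
  have h3 := Submodule.finrank_mono hβδ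
  rw [hn, hβ] at h2
  rw [Module.finrank_prod, Module.finrank_prod] at h1
  -- From `|T| - k ≤ dim ker δ` and `dim range δ ≥ |T| - k`, with `dim A = |T| - #cycles(a)` and
  -- likewise for `B` and `C`.
  omega

end Euler

/-! ### Homomorphisms from presented quandles -/

section Presented

variable {A : Type u} {X : Type v} [Quandle X]

/-- The value of a formal expression under an assignment of the generators. -/
def QTerm.eval (f : A → X) : QTerm A → X
  | .of a => f a
  | .act x y => x.eval f ◃ y.eval f
  | .invAct x y => x.eval f ◃⁻¹ y.eval f

theorem QRel.eval_eq {r : QTerm A → QTerm A → Prop} {f : A → X}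
    (hf : ∀ x y, r x y → x.eval f = y.eval f) {x y : QTerm A} (h : QRel r x y) :
    x.eval f = y.eval f := by
  induction h with
  | rel h => exact hf _ _ h
  | refl => rfl
  | symm _ ih => exact ih.symm
  | trans _ _ ih ih' => exact ih.trans ih'
  | act_congr _ _ ih ih' => exact congrArg₂ Shelf.act ih ih'
  | invAct_congr _ _ ih ih' => exact congrArg₂ Rack.invAct ih ih'
  | self_distrib => exact Shelf.self_distrib
  | left_inv => exact Rack.left_inv _ _
  | right_inv => exact Rack.right_inv _ _
  | fix => exact Quandle.fix

theorem shelfHom_map_invAct {R S : Type*} [Rack R] [Rack S] (φ : R →◃ S) (x y : R) :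
    φ (x ◃⁻¹ y) = φ x ◃⁻¹ φ y := by
  rw [← Rack.left_cancel (φ x), ← φ.map_act, Rack.right_inv, Rack.right_inv]

/-- The universal property of a presented quandle. -/
def presentedHomEquiv (r : QTerm A → QTerm A → Prop) :
    (PresentedQuandle r →◃ X) ≃ {f : A → X // ∀ x y, r x y → x.eval f = y.eval f} where
  toFun φ := ⟨fun a => φ (PresentedQuandle.mk r (.of a)), by
    have key : ∀ x : QTerm A, x.eval (fun a => φ (PresentedQuandle.mk r (.of a))) =
        φ (PresentedQuandle.mk r x) := by
      intro x
      induction x with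
      | of a => rfl
      | act x y ih ih' =>
        rw [QTerm.eval, ih, ih', ← φ.map_act]
        rfl
      | invAct x y ih ih' =>
        rw [QTerm.eval, ih, ih', ← shelfHom_map_invAct]
        rfl
    intro x y h
    rw [key, key]
    exact congrArg φ (Quotient.sound (QRel.rel h))⟩
  invFun f :=
    { toFun := Quotient.lift (QTerm.eval f.1) fun _ _ h => QRel.eval_eq f.2 h
      map_act' := by
        rintro ⟨x⟩ ⟨y⟩
        rfl }
  left_inv φ := by
    ext q
    obtain ⟨x, rfl⟩ := Quotient.exists_rep q
    change x.eval _ = φ (PresentedQuandle.mk r x)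
    induction x with
    | of a => rfl
    | act x y ih ih' =>
      rw [QTerm.eval, ih, ih', ← φ.map_act]
      rfl
    | invAct x y ih ih' =>
      rw [QTerm.eval, ih, ih', ← shelfHom_map_invAct]
      rfl
  right_inv _ := rfl

end Presented

/-! ### Colourings of diagrams -/

/-- The permutation `g` or its inverse, according to a sign. -/
def signed {G : Type*} [Group G] (b : Bool) (g : G) : G := cond b g g⁻¹

@[simp] theorem signed_true {G : Type*} [Group G] (g : G) : signed true g = g := rfl

@[simp] theorem signed_false {G : Type*} [Group G] (g : G) : signed false g = g⁻¹ := rfl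

namespace Diagram

variable {n : ℕ} {X : Type u} [Quandle X]

/-- The condition on the colours of the edges at a node. -/
def ColorsAt (D : Diagram n) (φ : D.Nodes → X) : D.Nodes → Prop
  | .over c => φ (.over c) = φ (D.next.symm (.over c))
  | .under c => φ (.under c) =
      signed (D.positive c) (Rack.act' (φ (.over c))) (φ (D.next.symm (.under c)))
  | .pt m => φ (.pt m) = φ (D.next.symm (.pt m))
  | .inf _ => True

/-- The colourings of a diagram, as functions on its edges. -/
def Coloring (D : Diagram n) (X : Type u) [Quandle X] : Type u :=
  {φ : D.Nodes → X // ∀ z, D.ColorsAt φ z}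

theorem coloring_of_arc (D : Diagram n) {f : D.Arc → X}
    (hf : ∀ x y, D.Relator x y → x.eval f = y.eval f) (z : D.Nodes) :
    D.ColorsAt (fun x => f (D.arc x)) z := by
  rcases z with c | c | m | i
  · exact congrArg f (Quot.sound (ArcStep.over c)).symm
  · cases h : D.positive c with
    | true =>
      have := hf _ _ (Relator.pos c h)
      simp only [ColorsAt, h, signed_true]
      exact this
    | false =>
      have := hf _ _ (Relator.neg c h)
      simp only [ColorsAt, h, signed_false]
      rw [Equiv.Perm.eq_inv_iff_eq]
      exact this.symm
  · exact congrArg f (Quot.sound (ArcStep.pt m)).symm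
  · trivial

/-- Assignments of colours to the arcs that satisfy the crossing relations are colourings. -/
def arcEquiv (D : Diagram n) (X : Type u) [Quandle X] :
    {f : D.Arc → X // ∀ x y, D.Relator x y → x.eval f = y.eval f} ≃ D.Coloring X where
  toFun f := ⟨fun x => f.1 (D.arc x), D.coloring_of_arc f.2⟩
  invFun φ := ⟨Quot.lift φ.1 (by
      rintro _ _ (c | m)
      · exact (φ.2 (.over c)).symm
      · exact (φ.2 (.pt m)).symm), by
    rintro _ _ (⟨c, h⟩ | ⟨c, h⟩)
    · have := φ.2 (.under c)
      simp only [ColorsAt, h, signed_true] at this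
      exact this
    · have := φ.2 (.under c)
      simp only [ColorsAt, h, signed_false] at this
      rw [Equiv.Perm.eq_inv_iff_eq] at this
      exact this.symm⟩
  left_inv f := Subtype.ext (funext fun a => by
    induction a using Quot.ind
    rfl)
  right_inv _ := rfl

/-- Homomorphisms from the fundamental quandle are colourings. -/
def homEquiv (D : Diagram n) (X : Type u) [Quandle X] :
    (D.FundamentalQuandle →◃ X) ≃ D.Coloring X :=
  (presentedHomEquiv _).trans (D.arcEquiv X)

theorem quandleCount_eq (D : Diagram n) : D.quandleCount X = Nat.card (D.Coloring X) :=
  Nat.card_congr (D.homEquiv X)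

instance (D : Diagram n) : Finite D.Nodes := by
  let e : D.Nodes → D.Crossing ⊕ D.Crossing ⊕ D.Point ⊕ Fin n
    | .over c => .inl c
    | .under c => .inr (.inl c)
    | .pt m => .inr (.inr (.inl m))
    | .inf i => .inr (.inr (.inr i))
  refine Finite.of_injective e ?_
  rintro (c | c | c | c) (d | d | d | d) h <;> simp [e] at h <;> rw [h]

instance (D : Diagram n) [Finite X] : Finite (D.Coloring X) :=
  inferInstanceAs (Finite {φ : D.Nodes → X // ∀ z, D.ColorsAt φ z})

/-- The colour of the leg of a 1-linkoid diagram. -/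
def Coloring.leg {D : Diagram 1} (φ : D.Coloring X) : X := φ.1 (.inf 0)

/-- The colour of the head of a 1-linkoid diagram. -/
def Coloring.head {D : Diagram 1} (φ : D.Coloring X) : X := φ.1 (D.next.symm (.inf 0))

theorem countingMatrix_apply (D : Diagram 1) (i j : X) :
    D.countingMatrix X i j = Nat.card {φ : D.Coloring X // φ.leg = i ∧ φ.head = j} := by
  refine Nat.card_congr ((D.homEquiv X).subtypeEquiv fun f => ?_)
  constructor
  · intro h
    exact ⟨h 0, h 1⟩
  · rintro ⟨h0, h1⟩ k
    fin_cases k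
    · exact h0
    · exact h1

theorem trace_countingMatrix [Fintype X] (D : Diagram 1) :
    (D.countingMatrix X).trace = Nat.card {φ : D.Coloring X // φ.leg = φ.head} := by
  simp only [Matrix.trace, Matrix.diag_apply, countingMatrix_apply]
  rw [← Nat.card_sigma]
  exact Nat.card_congr
    { toFun := fun p => ⟨p.2.1, p.2.2.1.trans p.2.2.2.symm⟩
      invFun := fun φ => ⟨φ.1.leg, φ.1, rfl, φ.2.symm⟩
      left_inv := by
        rintro ⟨_, φ, rfl, h⟩
        rfl
      right_inv := fun _ => rfl }

end Diagram

theorem signed_eq_iff {T : Type*} (b : Bool) (g : Equiv.Perm T) (x y : T) :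
    x = signed b g y ↔ y = signed (!b) g x := by
  cases b
  · exact Equiv.Perm.eq_inv_iff_eq.trans eq_comm
  · exact (eq_comm.trans Equiv.Perm.eq_inv_iff_eq.symm)

/-- An action of a quandle by permutations is compatible with the signed operation. -/
theorem map_signed_act {X : Type*} [Quandle X] {G : Type*} [Group G] {a : X → G}
    (ha : ∀ x z, a (x ◃ z) = a x * a z * (a x)⁻¹) (b : Bool) (x z : X) :
    a (signed b (Rack.act' x) z) = signed b (a x) * a z * (signed b (a x))⁻¹ := by
  cases b with
  | true => exact ha x z
  | false =>
    have := ha x (x ◃⁻¹ z)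
    rw [Rack.right_inv] at this
    rw [signed_false, signed_false, Rack.invAct_apply, this]
    group

namespace Diagram

/-! ### The branched cover of region colours and parallel transport -/

section Cover

variable {n : ℕ} {X : Type u} {Y : Type v} (a : X → Equiv.Perm Y)

/-- The permutation of the colours of the regions when an edge is crossed. -/
def holonomy (D : Diagram n) (φ : D.Nodes → X) : D.Dart → Equiv.Perm Y
  | (x, true) => a (φ x)
  | (x, false) => (a (φ (D.next.symm x)))⁻¹

/-- The rotation of the branched cover in which the regions are coloured by `Y`. -/
def coverRot (D : Diagram n) (φ : D.Nodes → X) : Equiv.Perm (D.Dart × Y) :=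
  Equiv.prodShear D.rot (D.holonomy a φ)

/-- The edge involution of the branched cover in which the regions are coloured by `Y`. -/
def coverFlip (D : Diagram n) (φ : D.Nodes → X) : Equiv.Perm (D.Dart × Y) :=
  Equiv.prodShear D.flip (D.holonomy a φ)

/-- Two points of the branched cover lie on the same component. -/
def CoverRel (D : Diagram n) (φ : D.Nodes → X) : Setoid (D.Dart × Y) :=
  MulAction.orbitRel (Subgroup.closure {D.coverRot a φ, D.coverFlip a φ}) (D.Dart × Y)

theorem coverRot_rel (D : Diagram n) (φ : D.Nodes → X) (d : D.Dart) (y : Y) :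
    D.CoverRel a φ (d, y) (D.rot d, D.holonomy a φ d y) :=
  (D.CoverRel a φ).symm (orbitRel_apply_left (D.coverRot a φ) (D.coverFlip a φ) (d, y))

theorem coverFlip_rel (D : Diagram n) (φ : D.Nodes → X) (d : D.Dart) (y : Y) :
    D.CoverRel a φ (d, y) (D.flip d, D.holonomy a φ d y) :=
  (D.CoverRel a φ).symm (orbitRel_apply_right (D.coverRot a φ) (D.coverFlip a φ) (d, y))

/-- Crossing an edge and crossing it back cancel. This is why walking around a face does not change
the sheet. -/
theorem holonomy_flip (D : Diagram n) (φ : D.Nodes → X) (d : D.Dart) :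
    D.holonomy a φ (D.flip d) = (D.holonomy a φ d)⁻¹ := by
  rcases d with ⟨x, _ | _⟩ <;> simp [holonomy, GaussDiagram.flip]

theorem coverFace_apply (D : Diagram n) (φ : D.Nodes → X) (p : D.Dart × Y) :
    (D.coverRot a φ * D.coverFlip a φ) p = (D.face p.1, p.2) := by
  obtain ⟨d, y⟩ := p
  change (D.rot (D.flip d), D.holonomy a φ (D.flip d) (D.holonomy a φ d y)) = _
  rw [holonomy_flip, Equiv.Perm.inv_def, Equiv.symm_apply_apply]
  rfl

theorem coverFace_rel (D : Diagram n) (φ : D.Nodes → X) (d : D.Dart) (y : Y) :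
    D.CoverRel a φ (d, y) (D.face d, y) := by
  refine (D.CoverRel a φ).trans (D.coverFlip_rel a φ d y) ?_
  have := D.coverRot_rel a φ (D.flip d) (D.holonomy a φ d y)
  rwa [holonomy_flip, Equiv.Perm.inv_def, Equiv.symm_apply_apply] at this

/-- The colour of the region on the right-hand side of an edge changes by this permutation when the
edge is followed past a node. -/
def transport (D : Diagram n) (φ : D.Nodes → X) : D.Nodes → Equiv.Perm Y
  | .over c => signed (!D.positive c)
      (a (bif D.positive c then φ (D.next.symm (.under c)) else φ (.under c)))
  | .under c => signed (D.positive c) (a (φ (.over c)))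
  | .pt _ => 1
  | .inf _ => 1

/-- Parallel transport past one node that is not an endpoint. -/
def ParStep (D : Diagram n) (φ : D.Nodes → X) (p q : D.Nodes × Y) : Prop :=
  D.next p.1 = q.1 ∧ (∀ i, q.1 ≠ .inf i) ∧ q.2 = D.transport a φ q.1 p.2

/-- Parallel transport along a strand. -/
def Par (D : Diagram n) (φ : D.Nodes → X) : D.Nodes × Y → D.Nodes × Y → Prop :=
  Relation.ReflTransGen (D.ParStep a φ)

/-- After one face step the walk has turned once at the next node. At a crossing it is then one
rotation short of the outgoing edge, and the holonomy of that rotation is the transport; at an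
auxiliary point it has already arrived. -/
theorem ParStep.coverRel [Quandle X] {D : Diagram n} {φ : D.Nodes → X} (hφ : ∀ z, D.ColorsAt φ z)
    {p q : D.Nodes × Y} (h : D.ParStep a φ p q) :
    D.CoverRel a φ ((p.1, true), p.2) ((q.1, true), q.2) := by
  obtain ⟨x, y⟩ := p
  obtain ⟨z, y'⟩ := q
  obtain ⟨h0, h1, h2⟩ := h
  change D.next x = z at h0
  subst h0
  change y' = D.transport a φ (D.next x) y at h2
  subst h2
  refine (D.CoverRel a φ).trans (D.coverFace_rel a φ (x, true) y) ?_
  change D.CoverRel a φ (D.rot (D.next x, false), y) _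
  change ∀ i, D.next x ≠ .inf i at h1
  change D.CoverRel a φ _ ((D.next x, true), D.transport a φ (D.next x) y)
  generalize D.next x = z at h1 ⊢
  rcases z with c | c | m | i
  · cases hc : D.positive c
    · have := D.coverRot_rel a φ (.under c, true) y
      simpa [GaussDiagram.rot, holonomy, transport, hc] using this
    · have := D.coverRot_rel a φ (.under c, false) y
      simpa [GaussDiagram.rot, holonomy, transport, hc] using this
  · have ho : φ (D.next.symm (.over c)) = φ (.over c) := (hφ (.over c)).symm
    cases hc : D.positive c
    · have := D.coverRot_rel a φ (.over c, false) y
      simpa [GaussDiagram.rot, holonomy, transport, hc, ho] using this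
    · have := D.coverRot_rel a φ (.over c, true) y
      simpa [GaussDiagram.rot, holonomy, transport, hc] using this
  · exact (D.CoverRel a φ).refl _
  · exact absurd rfl (h1 i)

theorem Par.coverRel [Quandle X] {D : Diagram n} {φ : D.Nodes → X} (hφ : ∀ z, D.ColorsAt φ z)
    {p q : D.Nodes × Y} (h : D.Par a φ p q) :
    D.CoverRel a φ ((p.1, true), p.2) ((q.1, true), q.2) := by
  induction h with
  | refl => exact (D.CoverRel a φ).refl _
  | tail _ h ih => exact (D.CoverRel a φ).trans ih (h.coverRel a hφ)

/-- The head has valence one, so the face walk along the last edge ends at the head's only dart, on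
the same sheet. -/
theorem coverRel_head (D : Diagram n) (φ : D.Nodes → X) (i : Fin n) (y : Y) :
    D.CoverRel a φ ((D.next.symm (.inf i), true), y) ((.inf i, false), y) := by
  have := D.coverFace_rel a φ (D.next.symm (.inf i), true) y
  simpa [GaussDiagram.face, GaussDiagram.flip, GaussDiagram.rot] using this

theorem exists_par (D : Diagram 1) (φ : D.Nodes → X) (y : Y) :
    ∃ y', D.Par a φ (.inf 0, y) (D.next.symm (.inf 0), y') := by
  have key : ∀ j : ℕ, ∃ y', D.Par a φ (.inf 0, y) ((D.next ^ j) (.inf 0), y') := by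
    intro j
    induction j with
    | zero => exact ⟨y, .refl⟩
    | succ j ih =>
      rw [pow_succ', Equiv.Perm.mul_apply]
      by_cases h : D.next ((D.next ^ j) (.inf 0)) = .inf 0
      · exact ⟨y, by rw [h]; exact .refl⟩
      · obtain ⟨y', hy'⟩ := ih
        refine ⟨D.transport a φ _ y', hy'.tail ⟨rfl, fun i => ?_, rfl⟩⟩
        rwa [Subsingleton.elim i 0]
  obtain ⟨j, hj⟩ : ∃ j : ℕ, (D.next ^ j) (.inf 0) = D.next.symm (.inf 0) := by
    have : D.next.SameCycle (.inf 0) (D.next.symm (.inf 0)) := ⟨-1, by simp⟩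
    obtain ⟨j, -, h⟩ := this.exists_pow_eq'
    exact ⟨j, h⟩
  rw [← hj]
  exact key j

theorem orbitRel_of_coverRel (D : Diagram n) (φ : D.Nodes → X) {p q : D.Dart × Y}
    (h : D.CoverRel a φ p q) :
    MulAction.orbitRel (Subgroup.closure {D.rot, D.flip}) D.Dart p.1 q.1 := by
  have := apply_eq_of_orbit (a := D.coverRot a φ) (b := D.coverFlip a φ)
    (f := fun p => (Quotient.mk (MulAction.orbitRel (Subgroup.closure {D.rot, D.flip}) D.Dart) p.1))
    (fun p => Quotient.sound (orbitRel_apply_left D.rot D.flip p.1))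
    (fun p => Quotient.sound (orbitRel_apply_right D.rot D.flip p.1)) h
  exact Quotient.exact this

/-- Paths lift to the branched cover. -/
theorem exists_coverRel (D : Diagram n) (φ : D.Nodes → X) {d d' : D.Dart}
    (h : MulAction.orbitRel (Subgroup.closure {D.rot, D.flip}) D.Dart d d') (y : Y) :
    ∃ y', D.CoverRel a φ (d, y) (d', y') := by
  -- The set of cover components met by the fibre over a dart is invariant under `rot` and `flip`,
  -- because the holonomy is a bijection between fibres.
  let f : D.Dart → Set (Quotient (D.CoverRel a φ)) :=
    fun d => Set.range fun y => Quotient.mk _ (d, y)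
  have key : ∀ (σ : Equiv.Perm D.Dart), (∀ d y, D.CoverRel a φ (d, y) (σ d, D.holonomy a φ d y)) →
      ∀ d, f (σ d) = f d := by
    intro σ hσ d
    ext q
    constructor
    · rintro ⟨y, rfl⟩
      refine ⟨(D.holonomy a φ d).symm y, Quotient.sound ?_⟩
      have := hσ d ((D.holonomy a φ d).symm y)
      rwa [Equiv.apply_symm_apply] at this
    · rintro ⟨y, rfl⟩
      exact ⟨_, Quotient.sound ((D.CoverRel a φ).symm (hσ d y))⟩
  have hf : f d = f d' :=
    apply_eq_of_orbit (key D.rot (D.coverRot_rel a φ)) (key D.flip (D.coverFlip_rel a φ)) h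
  have : Quotient.mk _ (d, y) ∈ f d' := hf ▸ ⟨y, rfl⟩
  obtain ⟨y', hy'⟩ := this
  exact ⟨y', Quotient.exact hy'.symm⟩

end Cover

/-! ### Euler characteristic of the cover of a planar diagram -/

section Planarity

variable {X : Type u} {Y : Type v} (a : X → Equiv.Perm Y)

/-- All four darts at a crossing lie in one cycle of `rot`. An upper bound suffices: through
planarity it bounds the number of faces from below. -/
theorem numVertices_le (D : Diagram 1) :
    D.numVertices ≤ Nat.card D.Crossing + Nat.card D.Point + 2 := by
  let r := Equiv.Perm.SameCycle.setoid D.rot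
  let f : (D.Crossing ⊕ D.Point) ⊕ Bool → Quotient r
    | .inl (.inl c) => Quotient.mk r (.over c, true)
    | .inl (.inr m) => Quotient.mk r (.pt m, true)
    | .inr b => Quotient.mk r (.inf 0, b)
  have hrot : ∀ d, Quotient.mk r d = Quotient.mk r (D.rot d) := fun d => Quotient.sound ⟨1, rfl⟩
  have hover : ∀ c b, Quotient.mk r (.over c, b) ∈ Set.range f := by
    rintro c (_ | _)
    · refine ⟨.inl (.inl c), ?_⟩
      change Quotient.mk r (.over c, true) = _
      rw [hrot, hrot (D.rot _)]
      cases h : D.positive c <;> simp [GaussDiagram.rot, h]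
    · exact ⟨.inl (.inl c), rfl⟩
  have hf : Function.Surjective f := by
    intro q
    obtain ⟨⟨c | c | m | i, b⟩, rfl⟩ := Quotient.exists_rep q
    · exact hover c b
    · change Quotient.mk r (.under c, b) ∈ Set.range f
      rw [hrot]
      exact hover c _
    · cases b with
      | true => exact ⟨.inl (.inr m), rfl⟩
      | false => exact ⟨.inl (.inr m), hrot _⟩
    · exact ⟨.inr b, by rw [Subsingleton.elim i 0]⟩
  have := Nat.card_le_card_of_surjective f hf
  rwa [Nat.card_sum, Nat.card_sum, Nat.card_eq_fintype_card (α := Bool), Fintype.card_bool] at this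

theorem card_le_coverFlip_cycles [Finite Y] (D : Diagram 1) (φ : D.Nodes → X) :
    Nat.card D.Nodes * Nat.card Y ≤
      Nat.card (Quotient (Equiv.Perm.SameCycle.setoid (D.coverFlip a φ))) := by
  let f : D.Dart × Y → D.Nodes × Y
    | ((x, true), y) => (x, y)
    | ((x, false), y) => (D.next.symm x, (a (φ (D.next.symm x)))⁻¹ y)
  have hf : ∀ p, f (D.coverFlip a φ p) = f p := by
    rintro ⟨⟨x, _ | _⟩, y⟩ <;>
    simp [f, coverFlip, Equiv.prodShear, GaussDiagram.flip, holonomy]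
  rw [← Nat.card_prod]
  refine Nat.card_le_card_of_surjective
    (Quotient.lift f fun _ _ h => apply_eq_of_sameCycle hf h) ?_
  rintro ⟨x, y⟩
  exact ⟨Quotient.mk _ ((x, true), y), rfl⟩

theorem card_le_coverFace_cycles [Finite Y] (D : Diagram 1) (φ : D.Nodes → X) :
    D.numFaces * Nat.card Y ≤
      Nat.card (Quotient (Equiv.Perm.SameCycle.setoid (D.coverRot a φ * D.coverFlip a φ))) := by
  let r := Equiv.Perm.SameCycle.setoid D.face
  let f : D.Dart × Y → Quotient r × Y := fun p => (Quotient.mk r p.1, p.2)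
  have hf : ∀ p, f ((D.coverRot a φ * D.coverFlip a φ) p) = f p := by
    intro p
    rw [coverFace_apply]
    exact Prod.ext (Quotient.sound ⟨-1, by simp⟩) rfl
  rw [GaussDiagram.numFaces, ← Nat.card_prod]
  refine Nat.card_le_card_of_surjective
    (Quotient.lift f fun _ _ h => apply_eq_of_sameCycle hf h) ?_
  rintro ⟨q, y⟩
  obtain ⟨d, rfl⟩ := Quotient.exists_rep q
  exact ⟨Quotient.mk _ (d, y), rfl⟩

/-- The crossing relation says that the holonomy around a crossing is trivial, so every crossing has
`|Y|` lifts, as has every auxiliary point. Over the endpoints the lifts are the cycles of the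
actions of leg and head. -/
theorem card_le_coverRot_cycles [Quandle X] [Finite Y]
    (ha : ∀ x z, a (x ◃ z) = a x * a z * (a x)⁻¹) {D : Diagram 1} (φ : D.Coloring X) :
    (Nat.card D.Crossing + Nat.card D.Point) * Nat.card Y +
      (Nat.card (Quotient (Equiv.Perm.SameCycle.setoid (a φ.leg))) +
        Nat.card (Quotient (Equiv.Perm.SameCycle.setoid (a φ.head)))) ≤
    Nat.card (Quotient (Equiv.Perm.SameCycle.setoid (D.coverRot a φ.1))) := by
  let rl := Equiv.Perm.SameCycle.setoid (a φ.leg)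
  let rh := Equiv.Perm.SameCycle.setoid (a φ.head)
  -- A lift of a vertex is labelled by its sheet at a reference dart, the outgoing over-dart of a
  -- crossing or the outgoing dart of an auxiliary point; the formulas rotate any other dart to it.
  let f : D.Dart × Y → ((D.Crossing ⊕ D.Point) × Y) ⊕ (Quotient rl ⊕ Quotient rh)
    | ((.over c, true), y) => .inl (.inl c, y)
    | ((.under c, b), y) => .inl (.inl c, cond (b == D.positive c) ((a (φ.1 (.over c)))⁻¹ y)
        (cond b (a (φ.1 (.under c)) y) ((a (φ.1 (D.next.symm (.under c))))⁻¹ y)))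
    | ((.over c, false), y) => .inl (.inl c, (a (φ.1 (.over c)))⁻¹
        (cond (D.positive c) ((a (φ.1 (.under c)))⁻¹ y) (a (φ.1 (D.next.symm (.under c))) y)))
    | ((.pt m, true), y) => .inl (.inr m, y)
    | ((.pt m, false), y) => .inl (.inr m, (a (φ.1 (.pt m)))⁻¹ y)
    | ((.inf _, true), y) => .inr (.inl (Quotient.mk rl y))
    | ((.inf _, false), y) => .inr (.inr (Quotient.mk rh y))
  have hf : ∀ p, f (D.coverRot a φ.1 p) = f p := by
    have ho : ∀ c, φ.1 (D.next.symm (.over c)) = φ.1 (.over c) := fun c => (φ.2 (.over c)).symm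
    have hp : ∀ c, φ.1 (D.next.symm (.pt c)) = φ.1 (.pt c) := fun c => (φ.2 (.pt c)).symm
    have hu : ∀ c, a (φ.1 (.under c)) = _ := fun c =>
      (congrArg a (φ.2 (.under c))).trans (map_signed_act ha _ _ _)
    rintro ⟨⟨c | c | m | i, b⟩, y⟩
    · cases b <;> cases hc : D.positive c <;>
      simp [f, coverRot, Equiv.prodShear, GaussDiagram.rot, holonomy, ho, hu, hc, Equiv.Perm.inv_def]
    · cases b <;> cases hc : D.positive c <;>
      simp [f, coverRot, Equiv.prodShear, GaussDiagram.rot, holonomy, hu, hc, Equiv.Perm.inv_def]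
    · cases b <;> simp [f, coverRot, Equiv.prodShear, GaussDiagram.rot, holonomy, hp]
    · rw [Subsingleton.elim i 0]
      cases b with
      | true =>
        exact congrArg (fun q => Sum.inr (Sum.inl q))
          (Quotient.sound (s := rl) ⟨-1, by
            simp [holonomy, Coloring.leg]⟩)
      | false =>
        exact congrArg (fun q => Sum.inr (Sum.inr q))
          (Quotient.sound (s := rh) ⟨1, by
            simp [holonomy, Coloring.head]⟩)
  have hsurj : Function.Surjective (Quotient.lift (s := Equiv.Perm.SameCycle.setoid
      (D.coverRot a φ.1)) f fun _ _ h => apply_eq_of_sameCycle hf h) := by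
    rintro (⟨c | m, y⟩ | q | q)
    · exact ⟨Quotient.mk _ ((.over c, true), y), rfl⟩
    · exact ⟨Quotient.mk _ ((.pt m, true), y), rfl⟩
    · obtain ⟨y, rfl⟩ := Quotient.exists_rep q
      exact ⟨Quotient.mk _ ((.inf 0, true), y), rfl⟩
    · obtain ⟨y, rfl⟩ := Quotient.exists_rep q
      exact ⟨Quotient.mk _ ((.inf 0, false), y), rfl⟩
  have := Nat.card_le_card_of_surjective _ hsurj
  rwa [Nat.card_sum, Nat.card_prod, Nat.card_sum, Nat.card_sum] at this

/-- The components of the branched cover, listed by those over a given component of the diagram and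
sheets over the other ones. -/
theorem exists_surjective_coverRel (D : Diagram 1) (φ : D.Nodes → X)
    (d : D.Dart) (g : Equiv.Perm Y) (hg : ∀ y, D.CoverRel a φ (d, y) (d, g y)) :
    ∃ f : {q : MulAction.orbitRel.Quotient (Subgroup.closure {D.rot, D.flip}) D.Dart //
          q ≠ Quotient.mk _ d} × Y ⊕ Quotient (Equiv.Perm.SameCycle.setoid g) →
        Quotient (D.CoverRel a φ),
      Function.Surjective f ∧
        ∀ y, f (.inr (Quotient.mk _ y)) = Quotient.mk (D.CoverRel a φ) (d, y) := by
  have hg' : ∀ y y', g.SameCycle y y' →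
      Quotient.mk (D.CoverRel a φ) (d, y) = Quotient.mk (D.CoverRel a φ) (d, y') := fun y y' h =>
    apply_eq_of_sameCycle (f := fun y => Quotient.mk (D.CoverRel a φ) (d, y))
      (fun y => Quotient.sound ((D.CoverRel a φ).symm (hg y))) h
  refine ⟨Sum.elim (fun p => Quotient.mk _ (p.1.1.out, p.2))
    (Quotient.lift (fun y => Quotient.mk _ (d, y)) hg'), ?_, fun _ => rfl⟩
  intro q
  obtain ⟨⟨d', y'⟩, rfl⟩ := Quotient.exists_rep q
  by_cases h : (Quotient.mk _ d' : MulAction.orbitRel.Quotient (Subgroup.closure {D.rot, D.flip})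
      D.Dart) = Quotient.mk _ d
  · obtain ⟨y, hy⟩ := D.exists_coverRel a φ (Quotient.exact h) y'
    exact ⟨.inr (Quotient.mk _ y), Quotient.sound ((D.CoverRel a φ).symm hy)⟩
  · obtain ⟨y, hy⟩ := D.exists_coverRel a φ
      ((MulAction.orbitRel _ _).symm (Quotient.mk_out d')) y'
    exact ⟨.inl (⟨Quotient.mk _ d', h⟩, y), Quotient.sound ((D.CoverRel a φ).symm hy)⟩

/-- On a planar diagram, transport of region colours from the head to itself is a power of the action
of the head. -/
theorem sameCycle_of_coverRel [Quandle X] [Finite Y]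
    (ha : ∀ x z, a (x ◃ z) = a x * a z * (a x)⁻¹) {D : Diagram 1} (φ : D.Coloring X) {y y' : Y}
    (h : D.CoverRel a φ.1 ((.inf 0, false), y) ((.inf 0, false), y')) :
    (a φ.head).SameCycle y y' := by
  have hleg : ∀ y, D.CoverRel a φ.1 ((.inf 0, true), y) ((.inf 0, true), a φ.leg y) := fun y =>
    D.coverRot_rel a φ.1 (.inf 0, true) y
  have hhead : ∀ y, D.CoverRel a φ.1 ((.inf 0, false), y) ((.inf 0, false), a φ.head y) := by
    intro y
    have := D.coverRot_rel a φ.1 (.inf 0, false) (a φ.head y)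
    refine (D.CoverRel a φ.1).symm ?_
    simpa [holonomy, GaussDiagram.rot, Coloring.head] using this
  obtain ⟨fl, hfl, -⟩ := D.exists_surjective_coverRel a φ.1 _ _ hleg
  obtain ⟨fh, hfh, hfh'⟩ := D.exists_surjective_coverRel a φ.1 _ _ hhead
  -- Leg and head lie on one piece of the diagram, being joined by the open strand; hence both
  -- surjections omit the same piece.
  have hpiece : (Quotient.mk _ (.inf 0, true) :
      MulAction.orbitRel.Quotient (Subgroup.closure {D.rot, D.flip}) D.Dart) =
      Quotient.mk _ (.inf 0, false) := by
    obtain ⟨y', hy'⟩ := D.exists_par a φ.1 y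
    exact Quotient.sound (D.orbitRel_of_coverRel a φ.1
      ((D.CoverRel a φ.1).trans (hy'.coverRel a φ.2) (D.coverRel_head a φ.1 0 y')))
  have hcl := Nat.card_le_card_of_surjective fl hfl
  have hch := Nat.card_le_card_of_surjective fh hfh
  rw [hpiece] at hcl
  have hk : Nat.card {q : MulAction.orbitRel.Quotient (Subgroup.closure {D.rot, D.flip}) D.Dart //
      q ≠ Quotient.mk _ (.inf 0, false)} + 1 = D.numPieces := by
    classical
    exact Finite.card_option.symm.trans (Nat.card_congr (Equiv.optionSubtypeNe _))
  have h1 := card_cycles_add_le (D.coverRot a φ.1) (D.coverFlip a φ.1)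
  have h2 := card_le_coverRot_cycles a ha φ
  have h3 := D.card_le_coverFlip_cycles a φ.1
  have h4 := D.card_le_coverFace_cycles a φ.1
  have h5 := Nat.mul_le_mul_right (Nat.card Y) D.numVertices_le
  have h6 : (D.numVertices + D.numFaces) * Nat.card Y =
    (D.numEdges + 2 * D.numPieces) * Nat.card Y := congrArg (· * Nat.card Y) D.planar
  have h7 : Nat.card (D.Dart × Y) = 2 * (D.numEdges * Nat.card Y) := by
    rw [Nat.card_prod, Nat.card_prod, Nat.card_eq_fintype_card (α := Bool), Fintype.card_bool,
      GaussDiagram.numEdges]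
    ring
  rw [h7] at h1
  rw [← hk] at h6
  rw [Nat.card_sum, Nat.card_prod] at hcl hch
  change D.numEdges * Nat.card Y ≤ _ at h3
  change _ ≤ _ + 2 * Nat.card (Quotient (D.CoverRel a φ.1)) at h1
  -- With `k'` other pieces, the Euler inequality and planarity give `2 * comp ≥ 2 * k' * |Y| +
  -- cyc(leg) + cyc(head)`, while the surjection for the leg gives `comp ≤ k' * |Y| + cyc(leg)`.
  -- Subtracting bounds `comp` below by the size of the source of `fh`, so `fh` identifies nothing.
  have hle : Nat.card ({q : MulAction.orbitRel.Quotient (Subgroup.closure {D.rot, D.flip})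
      D.Dart // q ≠ Quotient.mk _ (.inf 0, false)} × Y ⊕
        Quotient (Equiv.Perm.SameCycle.setoid (a φ.head))) ≤
      Nat.card (Quotient (D.CoverRel a φ.1)) := by
    rw [Nat.card_sum, Nat.card_prod]
    ring_nf at *
    omega
  have hbij := hfh.bijective_of_nat_card_le hle
  have := hbij.1 ((hfh' y).trans ((Quotient.sound h).trans (hfh' y').symm))
  exact Quotient.exact (Sum.inr_injective this)

end Planarity

end Diagram

theorem signed_act_self {X : Type*} [Quandle X] (b : Bool) (x : X) :
    signed b (Rack.act' x) x = x := by
  cases b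
  · exact Quandle.fix_inv
  · exact Quandle.fix

namespace Diagram

/-! ### Closing colourings and endpoints in a common region -/

section SameRegion

variable {X : Type u} [Quandle X]

/-- Parallel transport of the colour of the leg ends at the colour of the head. -/
def Coloring.Closes {D : Diagram 1} (φ : D.Coloring X) : Prop :=
  D.Par Rack.act' φ.1 (.inf 0, φ.leg) (D.next.symm (.inf 0), φ.head)

theorem Coloring.eq_head_of_sameCycle {D : Diagram 1} {φ : D.Coloring X} {y : X}
    (h : Equiv.Perm.SameCycle (Rack.act' φ.head) φ.head y) : y = φ.head := by
  obtain ⟨i, rfl⟩ := h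
  exact Equiv.Perm.zpow_apply_eq_self_of_apply_eq_self Quandle.fix i

/-- Two paths from leg to head differ by a loop at the head, whose effect is a power of the head's
action. By idempotence this power fixes the head's colour, so reaching that colour does not depend
on the path. -/
theorem Coloring.closes_iff [Finite X] {D : Diagram 1} (φ : D.Coloring X) {y : X}
    (h : D.CoverRel Rack.act' φ.1 ((.inf 0, true), φ.leg) ((.inf 0, false), y)) :
    φ.Closes ↔ y = φ.head := by
  have key : ∀ z, D.Par Rack.act' φ.1 (.inf 0, φ.leg) (D.next.symm (.inf 0), z) →
      Equiv.Perm.SameCycle (Rack.act' φ.head) z y := fun z hz =>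
    sameCycle_of_coverRel _ (fun _ _ => Rack.ad_conj _ _) φ ((D.CoverRel _ φ.1).trans
      ((D.CoverRel _ φ.1).symm ((D.CoverRel _ φ.1).trans (hz.coverRel _ φ.2)
        (D.coverRel_head _ φ.1 0 z))) h)
  constructor
  · intro hc
    exact eq_head_of_sameCycle (key _ hc)
  · rintro rfl
    obtain ⟨z, hz⟩ := D.exists_par Rack.act' φ.1 φ.leg
    have := eq_head_of_sameCycle (key z hz).symm
    rwa [this] at hz

theorem EndpointsInSameRegion.coverRel {X : Type u} {D : Diagram 1}
    (hD : D.EndpointsInSameRegion) {Y : Type v} (a : X → Equiv.Perm Y) (φ : D.Nodes → X) (y : Y) :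
    D.CoverRel a φ ((.inf 0, true), y) ((.inf 0, false), y) :=
  Quotient.exact (apply_eq_of_sameCycle (f := fun d => Quotient.mk (D.CoverRel a φ) (d, y))
    (fun d => Quotient.sound ((D.CoverRel a φ).symm (D.coverFace_rel a φ d y))) hD)

theorem EndpointsInSameRegion.closes_iff [Finite X] {D : Diagram 1}
    (hD : D.EndpointsInSameRegion) (φ : D.Coloring X) : φ.Closes ↔ φ.leg = φ.head :=
  φ.closes_iff (hD.coverRel _ _ _)

/-- If the endpoints of a diagram lie in the same region, then its leg and its head act alike. -/
theorem EndpointsInSameRegion.act_eq [Finite X] {D : Diagram 1}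
    (hD : D.EndpointsInSameRegion) (φ : D.Coloring X) :
    Rack.act' φ.leg = Rack.act' φ.head := by
  let N := orderOf (Rack.act' φ.head : Equiv.Perm X)
  have hN : NeZero N := ⟨(orderOf_pos _).ne'⟩
  -- The second coordinate records the winding number modulo the order of the head's action, just
  -- enough to identify the power of that action.
  let a : X → Equiv.Perm (X × ZMod N) := fun x =>
    Equiv.prodCongr (Rack.act' x) (Equiv.addRight 1)
  have ha : ∀ x z, a (x ◃ z) = a x * a z * (a x)⁻¹ := by
    intro x z
    ext ⟨p, k⟩
    · simp [a, Rack.ad_conj, Equiv.Perm.inv_def]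
    · simp [a, Equiv.Perm.inv_def]
  have hpow : ∀ (i : ℤ) p, ((a φ.head) ^ i) p = ((Rack.act' φ.head ^ i) p.1, p.2 + i) := by
    intro i
    induction i using Int.induction_on with
    | zero => simp
    | succ i ih =>
      intro p
      rw [zpow_add_one, zpow_add_one, Equiv.Perm.mul_apply, ih]
      simp [a]
      ring
    | pred i ih =>
      intro p
      rw [zpow_sub_one, zpow_sub_one, Equiv.Perm.mul_apply, ih]
      simp [a, Equiv.Perm.inv_def]
      ring
  have hfin : Finite (X × ZMod N) := inferInstance
  ext x
  -- The loop goes from the head to the leg inside the common region, once around the leg, and back.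
  -- Its monodromy is the leg's action and its winding number is one.
  have h1 := (D.CoverRel a φ.1).trans
    ((D.CoverRel a φ.1).symm (hD.coverRel a φ.1 (x, 0)))
    ((D.CoverRel a φ.1).trans (D.coverRot_rel a φ.1 (.inf 0, true) (x, 0))
      (hD.coverRel a φ.1 _))
  obtain ⟨i, hi⟩ := sameCycle_of_coverRel a ha φ h1
  rw [hpow] at hi
  have hi2 : ((i : ℤ) : ZMod N) = ((1 : ℤ) : ZMod N) := by
    simpa [a, holonomy] using congrArg Prod.snd hi
  have hi1 : ((Rack.act' φ.head : Equiv.Perm X) ^ i) x = Rack.act' φ.leg x := congrArg Prod.fst hi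
  rw [ZMod.intCast_eq_intCast_iff] at hi2
  rw [← hi1, zpow_eq_zpow_iff_modEq.2 hi2, zpow_one]

end SameRegion

end Diagram

theorem Node.map_injective {n : ℕ} {C M C' M' : Type} {f : C → C'} {g : M → M'}
    (hf : Function.Injective f) (hg : Function.Injective g) :
    Function.Injective (Node.map (n := n) f g) := by
  rintro (c | c | m | i) (c' | c' | m' | i') h <;>
  simp only [Node.map, Node.over.injEq, Node.under.injEq, Node.pt.injEq, Node.inf.injEq,
    reduceCtorEq] at h ⊢
  · exact hf h
  · exact hf h
  · exact hg h
  · exact h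

namespace Diagram

/-! ### Colourings under insertion of nodes into edges -/

section Expansion

variable {n : ℕ} {X : Type u} [Quandle X]

/-- The colourings of two diagrams correspond to each other, with the same colours and the same
parallel transport at the endpoints. -/
def Corresponds (D D' : Diagram n) (X : Type u) [Quandle X] : Prop :=
  ∃ e : D'.Coloring X ≃ D.Coloring X, ∀ φ,
    (∀ i, (e φ).1 (.inf i) = φ.1 (.inf i)) ∧
    (∀ i, (e φ).1 (D.next.symm (.inf i)) = φ.1 (D'.next.symm (.inf i))) ∧
    ∀ i y y', D.Par Rack.act' (e φ).1 (.inf i, y) (D.next.symm (.inf i), y') →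
      D'.Par Rack.act' φ.1 (.inf i, y) (D'.next.symm (.inf i), y')

variable {D D' : Diagram n} {f : D.Crossing → D'.Crossing} {g : D.Point → D'.Point}
  {ins : D.Nodes → List D'.Nodes}

theorem Expands.map_injective (h : Expands D D' f g ins) :
    Function.Injective (Node.map (n := n) f g) :=
  Node.map_injective h.f_inj h.g_inj

/-- Only the incoming edges of old nodes other than endpoints have to keep their colours. The
exemption lets the lemma apply to the under move, which recolours the head. -/
theorem Expands.colorsAt_map (h : Expands D D' f g ins) {φ : D'.Nodes → X}
    (hφ : ∀ z, (∀ i, z ≠ .inf i) →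
      φ (D'.next.symm (Node.map f g z)) = φ (Node.map f g (D.next.symm z))) (z : D.Nodes) :
    D'.ColorsAt φ (Node.map f g z) ↔ D.ColorsAt (fun x => φ (Node.map f g x)) z := by
  rcases z with c | c | m | i
  · have := hφ (.over c) (by simp)
    exact ⟨fun h' => h'.trans this, fun h' => h'.trans this.symm⟩
  · have := hφ (.under c) (by simp)
    simp only [Node.map] at this
    simp only [ColorsAt, Node.map, h.positive_eq, this]
  · have := hφ (.pt m) (by simp)
    exact ⟨fun h' => h'.trans this, fun h' => h'.trans this.symm⟩
  · exact Iff.rfl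

theorem Expands.transport_map {X : Type u} (h : Expands D D' f g ins) {Y : Type v} (a : X → Equiv.Perm Y)
    {φ : D'.Nodes → X}
    (hφ : ∀ z, (∀ i, z ≠ .inf i) →
      φ (D'.next.symm (Node.map f g z)) = φ (Node.map f g (D.next.symm z))) (z : D.Nodes) :
    D'.transport a φ (Node.map f g z) = D.transport a (fun x => φ (Node.map f g x)) z := by
  rcases z with c | c | m | i
  · have := hφ (.under c) (by simp)
    simp only [Node.map] at this
    simp only [transport, Node.map, h.positive_eq, this]
  · simp only [transport, Node.map, h.positive_eq]
  · rfl
  · rfl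

/-- Parallel transport in a diagram is carried to an expanded diagram. -/
theorem Expands.par_map {X : Type u} (h : Expands D D' f g ins) {Y : Type v} {a : X → Equiv.Perm Y}
    {φ : D'.Nodes → X}
    (hφ : ∀ z, (∀ i, z ≠ .inf i) →
      φ (D'.next.symm (Node.map f g z)) = φ (Node.map f g (D.next.symm z)))
    -- `S` will be parallel transport for Reidemeister moves, and the weaker relation of lying on
    -- one component of the cover for the under move.
    {S : D'.Nodes × Y → D'.Nodes × Y → Prop} (refl : ∀ p, S p p)
    (trans : ∀ {p q r}, S p q → S q r → S p r) (step : ∀ {p q}, D'.ParStep a φ p q → S p q)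
    (hS : ∀ z, (∀ i, z ≠ .inf i) → ∀ y,
      S (Node.map f g (D.next.symm z), y) (D'.next.symm (Node.map f g z), y))
    {p q : D.Nodes × Y} (hpq : D.Par a (fun x => φ (Node.map f g x)) p q) :
    S (Node.map f g p.1, p.2) (Node.map f g q.1, q.2) := by
  induction hpq with
  | refl => exact refl _
  | @tail q r _ hqr ih =>
    obtain ⟨h1, h2, h3⟩ := hqr
    have h4 := hS r.1 h2 q.2
    rw [← h1, Equiv.symm_apply_apply, h1] at h4
    refine trans ih (trans h4 (step ⟨Equiv.apply_symm_apply _ _, ?_, ?_⟩))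
    · intro i hi
      obtain ⟨c | c | m | j, y⟩ := r <;> simp [Node.map] at hi h2
    · rw [h3, h.transport_map a hφ]

/-- The bijection is restriction to the old edges. The three hypotheses make it well defined,
surjective and injective, respectively. -/
theorem Expands.exists_equiv (h : Expands D D' f g ins)
    (hprev : ∀ φ : D'.Coloring X, ∀ z, (∀ i, z ≠ .inf i) →
      φ.1 (D'.next.symm (Node.map f g z)) = φ.1 (Node.map f g (D.next.symm z)))
    (hext : ∀ φ : D.Coloring X, ∃ φ' : D'.Nodes → X, (∀ z, φ' (Node.map f g z) = φ.1 z) ∧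
      (∀ z, (∀ i, z ≠ .inf i) →
        φ' (D'.next.symm (Node.map f g z)) = φ' (Node.map f g (D.next.symm z))) ∧
      ∀ w, w ∉ Set.range (Node.map (n := n) f g) → D'.ColorsAt φ' w)
    (huniq : ∀ φ ψ : D'.Coloring X, (∀ z, φ.1 (Node.map f g z) = ψ.1 (Node.map f g z)) →
      ∀ w, w ∉ Set.range (Node.map (n := n) f g) → φ.1 w = ψ.1 w) :
    ∃ e : D'.Coloring X ≃ D.Coloring X, ∀ φ, (e φ).1 = fun x => φ.1 (Node.map f g x) := by
  let F : D'.Coloring X → D.Coloring X := fun φ =>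
    ⟨fun x => φ.1 (Node.map f g x), fun z => (h.colorsAt_map (hprev φ) z).1 (φ.2 _)⟩
  have hF : Function.Bijective F := by
    constructor
    · intro φ ψ hφψ
      have h1 : ∀ z, φ.1 (Node.map f g z) = ψ.1 (Node.map f g z) :=
        fun z => congrFun (congrArg Subtype.val hφψ) z
      refine Subtype.ext (funext fun w => ?_)
      by_cases hw : w ∈ Set.range (Node.map (n := n) f g)
      · obtain ⟨z, rfl⟩ := hw
        exact h1 z
      · exact huniq φ ψ h1 w hw
    · intro φ
      obtain ⟨φ', h1, h2, h3⟩ := hext φ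
      refine ⟨⟨φ', fun w => ?_⟩, Subtype.ext (funext h1)⟩
      by_cases hw : w ∈ Set.range (Node.map (n := n) f g)
      · obtain ⟨z, rfl⟩ := hw
        rw [h.colorsAt_map h2, show (fun x => φ' (Node.map f g x)) = φ.1 from funext h1]
        exact φ.2 z
      · exact h3 w hw
  exact ⟨Equiv.ofBijective F hF, fun _ => rfl⟩

/-- A sequence of nodes that changes neither the colour of a strand nor the parallel transport along
it. -/
def Inert (D : Diagram n) (φ : D.Nodes → X) (l : List D.Nodes) : Prop :=
  ∀ p, List.IsChain (fun a b => D.next a = b) (p :: l) →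
    φ ((p :: l).getLast (List.cons_ne_nil _ _)) = φ p ∧
    ∀ y : X, D.Par Rack.act' φ (p, y) ((p :: l).getLast (List.cons_ne_nil _ _), y)

theorem inert_nil (D : Diagram n) (φ : D.Nodes → X) : D.Inert φ [] :=
  fun _ _ => ⟨rfl, fun _ => .refl⟩

/-- Needed because a Reidemeister II move of an edge with itself inserts both pairs of passages into
the same edge. -/
theorem Inert.append {D : Diagram n} {φ : D.Nodes → X} {l l' : List D.Nodes}
    (h : D.Inert φ l) (h' : D.Inert φ l') : D.Inert φ (l ++ l') := by
  intro p hp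
  have hp' : ((p :: l) ++ l').IsChain (fun a b => D.next a = b) := hp
  obtain ⟨h1, h2, h3⟩ := List.isChain_append.1 hp'
  obtain ⟨h4, h5⟩ := h p h1
  have h6 : (((p :: l).getLast (List.cons_ne_nil _ _)) :: l').IsChain
      (fun a b => D.next a = b) := by
    rw [List.isChain_cons]
    exact ⟨fun y hy => h3 _ (List.getLast_mem_getLast? _) _ hy, h2⟩
  obtain ⟨h7, h8⟩ := h' _ h6
  have h9 : (p :: (l ++ l')).getLast (List.cons_ne_nil _ _) =
      (((p :: l).getLast (List.cons_ne_nil _ _)) :: l').getLast (List.cons_ne_nil _ _) := by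
    rcases l' with _ | ⟨b, l'⟩
    · simp
    · change ((p :: l) ++ (b :: l')).getLast _ = _
      rw [List.getLast_append_of_ne_nil _ (List.cons_ne_nil _ _)]
      exact (List.getLast_cons (List.cons_ne_nil _ _)).symm
  rw [h9]
  exact ⟨h7.trans h4, fun y => (h5 y).trans (h8 y)⟩

theorem Inert.insertAt {D : Diagram n} {φ : D.Nodes → X} {l : List D.Nodes} (h : D.Inert φ l)
    {A : Type} (x z : A) : D.Inert φ (insertAt x l z) := by
  unfold Diagram.insertAt
  split_ifs
  · exact h
  · exact inert_nil D φ

theorem Expands.symm_next_map (h : Expands D D' f g ins) (z : D.Nodes) :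
    D'.next.symm (Node.map f g z) = (Node.map f g (D.next.symm z) ::
      ins (D.next.symm z)).getLast (List.cons_ne_nil _ _) := by
  have := h.chain (D.next.symm z)
  rw [Equiv.apply_symm_apply, ← List.cons_append] at this
  obtain ⟨-, -, h3⟩ := List.isChain_append.1 this
  rw [Equiv.symm_apply_eq]
  exact (h3 _ (List.getLast_mem_getLast? _) _ rfl).symm

theorem Expands.isChain (h : Expands D D' f g ins) (z : D.Nodes) :
    (Node.map f g z :: ins z).IsChain (fun a b => D'.next a = b) := by
  have := h.chain z
  rw [← List.cons_append] at this
  exact (List.isChain_append.1 this).1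

/-- The insertion of inert sequences does not change the colourings. -/
theorem Expands.corresponds (h : Expands D D' f g ins)
    (hins : ∀ (φ : D'.Coloring X) x, D'.Inert φ.1 (ins x))
    (hext : ∀ φ : D.Coloring X, ∃ φ' : D'.Nodes → X, (∀ z, φ' (Node.map f g z) = φ.1 z) ∧
      (∀ z, φ' (D'.next.symm (Node.map f g z)) = φ' (Node.map f g (D.next.symm z))) ∧
      ∀ w, w ∉ Set.range (Node.map (n := n) f g) → D'.ColorsAt φ' w)
    (huniq : ∀ φ ψ : D'.Coloring X, (∀ z, φ.1 (Node.map f g z) = ψ.1 (Node.map f g z)) →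
      ∀ w, w ∉ Set.range (Node.map (n := n) f g) → φ.1 w = ψ.1 w) :
    Corresponds D D' X := by
  have hprev : ∀ (φ : D'.Coloring X) z,
      φ.1 (D'.next.symm (Node.map f g z)) = φ.1 (Node.map f g (D.next.symm z)) := by
    intro φ z
    rw [h.symm_next_map]
    exact (hins φ _ _ (h.isChain _)).1
  have hpar : ∀ (φ : D'.Coloring X) z y, D'.Par Rack.act' φ.1
      (Node.map f g (D.next.symm z), y) (D'.next.symm (Node.map f g z), y) := by
    intro φ z y
    rw [h.symm_next_map]
    exact (hins φ _ _ (h.isChain _)).2 y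
  obtain ⟨e, he⟩ := h.exists_equiv (fun φ z _ => hprev φ z)
    (fun φ => (hext φ).imp fun _ h' => ⟨h'.1, fun z _ => h'.2.1 z, h'.2.2⟩) huniq
  refine ⟨e, fun φ => ⟨fun i => ?_, fun i => ?_, fun i y y' hy => ?_⟩⟩
  · rw [he]
    rfl
  · rw [he]
    exact (hprev φ (.inf i)).symm
  · rw [he] at hy
    exact (h.par_map (fun z _ => hprev φ z) (S := D'.Par Rack.act' φ.1) (fun _ => .refl)
      Relation.ReflTransGen.trans Relation.ReflTransGen.single (fun z _ => hpar φ z) hy).trans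
        (hpar φ (.inf i) y')

end Expansion

/-! ### Relabelling, auxiliary points and Reidemeister I -/

section FirstMoves

variable {n : ℕ} {X : Type u} [Quandle X] {D D' : Diagram n} {f : D.Crossing → D'.Crossing}
  {g : D.Point → D'.Point} {ins : D.Nodes → List D'.Nodes}

theorem Expands.symm_next_map_of_eq_nil (h : Expands D D' f g ins) {z : D.Nodes}
    (hz : ins (D.next.symm z) = []) :
    D'.next.symm (Node.map f g z) = Node.map f g (D.next.symm z) := by
  rw [h.symm_next_map]
  simp [hz]

theorem over_mem_range_map {f : D.Crossing → D'.Crossing} {g : D.Point → D'.Point}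
    {k : D'.Crossing} :
    (.over k : D'.Nodes) ∈ Set.range (Node.map (n := n) f g) ↔ k ∈ Set.range f := by
  constructor
  · rintro ⟨c | c | c | c, h⟩ <;> simp [Node.map] at h
    exact ⟨c, h⟩
  · rintro ⟨c, rfl⟩
    exact ⟨.over c, rfl⟩

theorem under_mem_range_map {f : D.Crossing → D'.Crossing} {g : D.Point → D'.Point}
    {k : D'.Crossing} :
    (.under k : D'.Nodes) ∈ Set.range (Node.map (n := n) f g) ↔ k ∈ Set.range f := by
  constructor
  · rintro ⟨c | c | c | c, h⟩ <;> simp [Node.map] at h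
    exact ⟨c, h⟩
  · rintro ⟨c, rfl⟩
    exact ⟨.under c, rfl⟩

theorem pt_mem_range_map {f : D.Crossing → D'.Crossing} {g : D.Point → D'.Point}
    {k : D'.Point} :
    (.pt k : D'.Nodes) ∈ Set.range (Node.map (n := n) f g) ↔ k ∈ Set.range g := by
  constructor
  · rintro ⟨c | c | c | c, h⟩ <;> simp [Node.map] at h
    exact ⟨c, h⟩
  · rintro ⟨c, rfl⟩
    exact ⟨.pt c, rfl⟩

theorem inf_mem_range_map {f : D.Crossing → D'.Crossing} {g : D.Point → D'.Point} {i : Fin n} :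
    (.inf i : D'.Nodes) ∈ Set.range (Node.map (n := n) f g) :=
  ⟨.inf i, rfl⟩

/-- If no points are inserted, the new nodes belong to new crossings. -/
theorem eq_of_notMem_range_map {f : D.Crossing → D'.Crossing} {g : D.Point → D'.Point}
    (hg : Function.Surjective g) {w : D'.Nodes}
    (hw : w ∉ Set.range (Node.map (n := n) f g)) :
    ∃ k ∉ Set.range f, w = .over k ∨ w = .under k := by
  rcases w with k | k | m | i
  · exact ⟨k, fun hk => hw (over_mem_range_map.2 hk), .inl rfl⟩
  · exact ⟨k, fun hk => hw (under_mem_range_map.2 hk), .inr rfl⟩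
  · exact absurd (pt_mem_range_map.2 (hg m)) hw
  · exact absurd inf_mem_range_map hw

theorem Expands.corresponds_relabel (hf : Function.Surjective f) (hg : Function.Surjective g)
    (h : Expands D D' f g fun _ => []) : Corresponds D D' X := by
  have hsurj : Function.Surjective (Node.map (n := n) f g) := fun w => by
    by_contra hw
    obtain ⟨k, hk, -⟩ := eq_of_notMem_range_map hg hw
    exact hk (hf k)
  refine h.corresponds (fun φ x => inert_nil _ _) (fun φ => ?_)
    (fun φ ψ _ w hw => absurd (hsurj w) hw)
  refine ⟨fun w => φ.1 (Function.surjInv hsurj w), fun z => ?_, fun z => ?_,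
    fun w hw => absurd (hsurj w) hw⟩
  · exact congrArg φ.1 (Function.leftInverse_surjInv ⟨h.map_injective, hsurj⟩ z)
  · rw [h.symm_next_map_of_eq_nil rfl]

theorem par_single {D : Diagram n} {φ : D.Nodes → X} {p q : D.Nodes} (hpq : D.next p = q)
    (hq : ∀ i, q ≠ .inf i) (y : X) :
    D.Par Rack.act' φ (p, y) (q, D.transport Rack.act' φ q y) :=
  .single ⟨hpq, hq, rfl⟩

theorem Expands.corresponds_point (x : D.Nodes) (m : D'.Point) (hf : Function.Surjective f)
    (hg : Set.range g = {m}ᶜ) (h : Expands D D' f g (insertAt x [.pt m])) :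
    Corresponds D D' X := by
  have hnew : ∀ w, w ∉ Set.range (Node.map (n := n) f g) → w = .pt m := by
    rintro (c | c | m' | i) hw
    · exact absurd (over_mem_range_map.2 (hf c)) hw
    · exact absurd (under_mem_range_map.2 (hf c)) hw
    · rw [pt_mem_range_map, hg, Set.mem_compl_iff, not_not, Set.mem_singleton_iff] at hw
      rw [hw]
    · exact absurd inf_mem_range_map hw
  have hm : (.pt m : D'.Nodes) ∉ Set.range (Node.map (n := n) f g) := by
    rw [pt_mem_range_map, hg]
    simp
  have hx : D'.next (Node.map f g x) = .pt m := by
    have := h.chain x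
    simp only [insertAt, if_true, List.cons_append, List.isChain_cons_cons] at this
    exact this.1
  have hx' : D'.next.symm (.pt m) = Node.map f g x := by rw [← hx, Equiv.symm_apply_apply]
  refine h.corresponds (fun φ z => Inert.insertAt ?_ x z) (fun φ => ?_) (fun φ ψ hφψ w hw => ?_)
  · intro p hp
    simp only [List.isChain_cons_cons] at hp
    refine ⟨?_, fun y => par_single hp.1 (by simp) y⟩
    have := φ.2 (.pt m)
    simp only [ColorsAt, ← hp.1, Equiv.symm_apply_apply] at this
    simpa [← hp.1] using this
  · have hφ := fun z => h.map_injective.extend_apply φ.1 (fun _ => φ.1 x) z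
    have hψ : ∀ w, w ∉ Set.range (Node.map (n := n) f g) → _ :=
      fun w hw => Function.extend_apply' φ.1 (fun _ => φ.1 x) w hw
    refine ⟨_, hφ, fun z => ?_, fun w hw => ?_⟩
    · by_cases hz : D.next.symm z = x
      · have : D'.next.symm (Node.map f g z) = .pt m := by
          rw [h.symm_next_map]
          simp [insertAt, hz]
        rw [this, hψ _ hm, hφ, hz]
      · rw [h.symm_next_map_of_eq_nil (by simp [insertAt, hz])]
    · rw [hnew w hw]
      change Function.extend _ _ _ _ = Function.extend _ _ _ _
      rw [hψ _ hm, hx', hφ]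
  · have h1 := φ.2 (.pt m)
    have h2 := ψ.2 (.pt m)
    rw [hnew w hw]
    simp only [ColorsAt, hx'] at h1 h2
    rw [h1, h2, hφψ]

theorem transport_over_under (D : Diagram n) {φ : D.Nodes → X} {k : D.Crossing} {c : X}
    (h1 : φ (.over k) = c) (h2 : φ (.under k) = c) (h3 : φ (D.next.symm (.under k)) = c) (y : X) :
    D.transport Rack.act' φ (.under k) (D.transport Rack.act' φ (.over k) y) = y ∧
    D.transport Rack.act' φ (.over k) (D.transport Rack.act' φ (.under k) y) = y := by
  cases h : D.positive k <;> simp [transport, h, h1, h2, h3, Equiv.Perm.inv_def]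

/-- By idempotence all edges of a kink have one colour, and the over- and under-passage then
transport by mutually inverse permutations. -/
theorem inert_kink (D : Diagram n) (φ : D.Coloring X) {k : D.Crossing} {l : List D.Nodes}
    (hl : l = [.over k, .under k] ∨ l = [.under k, .over k]) : D.Inert φ.1 l := by
  have ho : φ.1 (.over k) = φ.1 (D.next.symm (.over k)) := φ.2 (.over k)
  have hu : φ.1 (.under k) = signed (D.positive k) (Rack.act' (φ.1 (.over k)))
    (φ.1 (D.next.symm (.under k))) := φ.2 (.under k)
  rcases hl with rfl | rfl <;> intro p hp <;> simp only [List.isChain_cons_cons] at hp <;>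
  obtain ⟨h1, h2, -⟩ := hp
  · rw [← h1, Equiv.symm_apply_apply, h1] at ho
    have h3 : D.next.symm (.under k) = .over k := by rw [← h2, Equiv.symm_apply_apply]
    rw [h3, signed_act_self, ho] at hu
    refine ⟨hu, fun y => ?_⟩
    have := (par_single (φ := φ.1) h1 (by simp) y).trans (par_single h2 (by simp) _)
    rwa [(D.transport_over_under ho hu (h3 ▸ ho) y).1] at this
  · have h3 : D.next.symm (.under k) = p := by rw [← h1, Equiv.symm_apply_apply]
    have h4 : D.next.symm (.over k) = .under k := by rw [← h2, Equiv.symm_apply_apply]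
    rw [h3] at hu
    rw [h4] at ho
    rw [ho, signed_eq_iff, signed_act_self] at hu
    refine ⟨ho.trans hu.symm, fun y => ?_⟩
    have := (par_single (φ := φ.1) h1 (by simp) y).trans (par_single h2 (by simp) _)
    rwa [(D.transport_over_under (ho.trans hu.symm) hu.symm (congrArg φ.1 h3) y).2] at this

theorem Expands.corresponds_kink (x : D.Nodes) (k : D'.Crossing) (l : List D'.Nodes)
    (hf : Set.range f = {k}ᶜ) (hg : Function.Surjective g)
    (hl : l = [.over k, .under k] ∨ l = [.under k, .over k])
    (h : Expands D D' f g (insertAt x l)) : Corresponds D D' X := by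
  have hk : k ∉ Set.range f := by simp [hf]
  have hnew : ∀ w, w ∉ Set.range (Node.map (n := n) f g) → w = .over k ∨ w = .under k := by
    intro w hw
    obtain ⟨k', hk', hw'⟩ := eq_of_notMem_range_map hg hw
    rw [hf, Set.mem_compl_iff, not_not, Set.mem_singleton_iff] at hk'
    rwa [hk'] at hw'
  have hchain := h.isChain x
  simp only [insertAt, if_true] at hchain
  refine h.corresponds (fun φ z => Inert.insertAt (inert_kink D' φ hl) x z) (fun φ => ?_)
    (fun φ ψ hφψ w hw => ?_)
  · have hφ := fun z => h.map_injective.extend_apply φ.1 (fun _ => φ.1 x) z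
    have hψ : ∀ w, w ∉ Set.range (Node.map (n := n) f g) → _ :=
      fun w hw => Function.extend_apply' φ.1 (fun _ => φ.1 x) w hw
    have ho := hψ (.over k) (fun hw => hk (over_mem_range_map.1 hw))
    have hu := hψ (.under k) (fun hw => hk (under_mem_range_map.1 hw))
    set φ' := Function.extend (Node.map f g) φ.1 (fun _ => φ.1 x)
    have hprev : φ' (D'.next.symm (.over k)) = φ.1 x ∧ φ' (D'.next.symm (.under k)) = φ.1 x := by
      rcases hl with rfl | rfl <;> simp only [List.isChain_cons_cons] at hchain <;>
      rw [(Equiv.symm_apply_eq _).2 hchain.1.symm, (Equiv.symm_apply_eq _).2 hchain.2.1.symm]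
      · exact ⟨hφ x, ho⟩
      · exact ⟨hu, hφ x⟩
    refine ⟨φ', hφ, fun z => ?_, fun w hw => ?_⟩
    · by_cases hz : D.next.symm z = x
      · rw [hφ, hz, h.symm_next_map, hz]
        rcases hl with rfl | rfl <;> simpa [insertAt]
      · rw [h.symm_next_map_of_eq_nil (by simp [insertAt, hz])]
    · rcases hnew w hw with rfl | rfl
      · exact ho.trans hprev.1.symm
      · simp only [ColorsAt, ho, hu, hprev.2, signed_act_self]
  · have key : ∀ φ : D'.Coloring X, φ.1 (.over k) = φ.1 (Node.map f g x) ∧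
        φ.1 (.under k) = φ.1 (Node.map f g x) := by
      intro φ
      have h1 := (inert_kink D' φ hl _ hchain).1
      have ho : φ.1 (.over k) = φ.1 (D'.next.symm (.over k)) := φ.2 (.over k)
      have hu : φ.1 (.under k) = signed (D'.positive k) (Rack.act' (φ.1 (.over k)))
        (φ.1 (D'.next.symm (.under k))) := φ.2 (.under k)
      rcases hl with rfl | rfl <;> simp only [List.isChain_cons_cons] at hchain
      · rw [← hchain.1, Equiv.symm_apply_apply, hchain.1] at ho
        exact ⟨ho, h1⟩
      · rw [← hchain.2.1, Equiv.symm_apply_apply, hchain.2.1] at ho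
        exact ⟨h1, ho.symm.trans h1⟩
    rcases hnew w hw with rfl | rfl
    · rw [(key φ).1, (key ψ).1, hφψ]
    · rw [(key φ).2, (key ψ).2, hφψ]

end FirstMoves

/-! ### Reidemeister II -/

section SecondMove

variable {n : ℕ} {X : Type u} [Quandle X] {D D' : Diagram n} {f : D.Crossing → D'.Crossing}
  {g : D.Point → D'.Point} {ins : D.Nodes → List D'.Nodes}

/-- The lower strand is acted on by the same colour twice, with opposite signs. -/
theorem inert_under_pair (D : Diagram n) (φ : D.Coloring X) {p q : D.Crossing}
    (hs : D.positive q = !D.positive p) (ho : φ.1 (.over q) = φ.1 (.over p)) :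
    D.Inert φ.1 [.under p, .under q] := by
  intro r hr
  simp only [List.isChain_cons_cons] at hr
  obtain ⟨h1, h2, -⟩ := hr
  have hp : φ.1 (.under p) = signed (D.positive p) (Rack.act' (φ.1 (.over p)))
    (φ.1 (D.next.symm (.under p))) := φ.2 (.under p)
  have hq : φ.1 (.under q) = signed (D.positive q) (Rack.act' (φ.1 (.over q)))
    (φ.1 (D.next.symm (.under q))) := φ.2 (.under q)
  rw [(Equiv.symm_apply_eq _).2 h1.symm] at hp
  rw [(Equiv.symm_apply_eq _).2 h2.symm, ho, hs, ← signed_eq_iff] at hq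
  refine ⟨?_, fun y => ?_⟩
  · rw [hp] at hq
    exact ((Equiv.injective _) hq).symm
  · have := (par_single (φ := φ.1) h1 (by simp) y).trans (par_single h2 (by simp) _)
    have h3 : D.transport Rack.act' φ.1 (.under q) (D.transport Rack.act' φ.1 (.under p) y) = y := by
      simp only [transport, ho, hs]
      rw [eq_comm, signed_eq_iff, Bool.not_not]
    rwa [h3] at this

/-- Transport along the upper strand acts by a lower colour at each crossing: the outer one at both
if `p` is positive, the inner one at both if `p` is negative. In either case the two actions cancel,
in whichever order the upper strand meets them. -/
theorem inert_over_pair (D : Diagram n) (φ : D.Coloring X) {p q p' q' : D.Crossing}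
    (hs : D.positive q = !D.positive p) (ho : φ.1 (.over q) = φ.1 (.over p))
    (hu : D.next (.under p) = .under q) (hpq : p' = p ∧ q' = q ∨ p' = q ∧ q' = p) :
    D.Inert φ.1 [.over p', .over q'] := by
  have hp : φ.1 (.under p) = signed (D.positive p) (Rack.act' (φ.1 (.over p)))
    (φ.1 (D.next.symm (.under p))) := φ.2 (.under p)
  have hq : φ.1 (.under q) = signed (D.positive q) (Rack.act' (φ.1 (.over q)))
    (φ.1 (D.next.symm (.under q))) := φ.2 (.under q)
  have hprev := (Equiv.symm_apply_eq D.next).2 hu.symm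
  rw [hprev, ho, hs, ← signed_eq_iff, hp] at hq
  replace hq := (Equiv.injective _) hq
  intro r hr
  simp only [List.isChain_cons_cons] at hr
  obtain ⟨h1, h2, -⟩ := hr
  refine ⟨?_, fun y => ?_⟩
  · have h3 : φ.1 (.over q') = φ.1 (D.next.symm (.over q')) := φ.2 (.over q')
    have h4 : φ.1 (.over p') = φ.1 (D.next.symm (.over p')) := φ.2 (.over p')
    rw [(Equiv.symm_apply_eq _).2 h2.symm] at h3
    rw [(Equiv.symm_apply_eq _).2 h1.symm] at h4
    exact h3.trans h4
  · have := (par_single (φ := φ.1) h1 (by simp) y).trans (par_single h2 (by simp) _)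
    have h3 : D.transport Rack.act' φ.1 (.over q') (D.transport Rack.act' φ.1 (.over p') y) = y := by
      cases hc : D.positive p <;> rcases hpq with ⟨rfl, rfl⟩ | ⟨rfl, rfl⟩ <;>
      simp [transport, hs, hc, hprev, hq, Equiv.Perm.inv_def]
    rwa [h3] at this

/-- If another inert list precedes `l` in the same edge, then `l` is still entered with the colour
of that edge. -/
theorem Inert.exists_chain {D : Diagram n} {φ : D.Nodes → X} {A : List D.Nodes}
    (hA : D.Inert φ A) {l B : List D.Nodes} {a : D.Nodes}
    (h : (a :: (A ++ l ++ B)).IsChain (fun a b => D.next a = b)) :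
    ∃ p, φ p = φ a ∧ (p :: l).IsChain (fun a b => D.next a = b) := by
  rw [← List.cons_append, ← List.cons_append] at h
  obtain ⟨h1, h2, h3⟩ := List.isChain_append.1 (List.isChain_append.1 h).1
  refine ⟨_, (hA a h1).1, ?_⟩
  rw [List.isChain_cons]
  exact ⟨fun y hy => h3 _ (List.getLast_mem_getLast? _) _ hy, h2⟩

/-- A sequence of nodes that is coloured correctly if it is entered with the colour `c`, and that is
left with the same colour. -/
def Fits (D : Diagram n) (φ : D.Nodes → X) (c : X) (l : List D.Nodes) : Prop :=
  ∀ p, List.IsChain (fun a b => D.next a = b) (p :: l) → φ p = c →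
    φ ((p :: l).getLast (List.cons_ne_nil _ _)) = c ∧ ∀ w ∈ l, D.ColorsAt φ w

theorem fits_nil (D : Diagram n) (φ : D.Nodes → X) (c : X) : D.Fits φ c [] :=
  fun _ _ h => ⟨h, by simp⟩

theorem Fits.append {D : Diagram n} {φ : D.Nodes → X} {c : X} {l l' : List D.Nodes}
    (h : D.Fits φ c l) (h' : D.Fits φ c l') : D.Fits φ c (l ++ l') := by
  intro p hp hc
  rw [← List.cons_append] at hp
  obtain ⟨h1, h2, h3⟩ := List.isChain_append.1 hp
  obtain ⟨h4, h5⟩ := h p h1 hc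
  obtain ⟨h7, h8⟩ := h' ((p :: l).getLast (List.cons_ne_nil _ _)) (by
    rw [List.isChain_cons]
    exact ⟨fun y hy => h3 _ (List.getLast_mem_getLast? _) _ hy, h2⟩) h4
  refine ⟨?_, fun w hw => (List.mem_append.1 hw).elim (h5 w) (h8 w)⟩
  rcases l' with _ | ⟨b, l'⟩
  · simpa using h4
  · change φ (((p :: l) ++ (b :: l')).getLast _) = _
    rw [List.getLast_append_of_ne_nil _ (List.cons_ne_nil _ _)]
    rwa [List.getLast_cons (List.cons_ne_nil _ _)] at h7

theorem Fits.insertAt {D : Diagram n} {φ : D.Nodes → X} {A : Type} {c : A → X} {x : A}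
    {l : List D.Nodes} (h : D.Fits φ (c x) l) (z : A) : D.Fits φ (c z) (insertAt x l z) := by
  unfold Diagram.insertAt
  split_ifs with hz
  · rwa [hz]
  · exact fits_nil D φ _

/-- Here `p`, `q` are in the order of the lower strand and `p'`, `q'` in that of the upper one. Of
the new edges, only the one leaving `under p` gets a colour other than that of `x` or `y`, and that
colour is forced. -/
theorem Expands.corresponds_bigon (x y : D.Nodes) (p q p' q' : D'.Crossing)
    (hpq : p ≠ q) (hs : D'.positive q = !D'.positive p) (hf : Set.range f = {p, q}ᶜ)
    (hg : Function.Surjective g) (hpq' : p' = p ∧ q' = q ∨ p' = q ∧ q' = p)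
    (hins : (ins = fun z => insertAt x [.over p', .over q'] z ++
        insertAt y [.under p, .under q] z) ∨
      (ins = fun z => insertAt y [.under p, .under q] z ++ insertAt x [.over p', .over q'] z))
    (h : Expands D D' f g ins) : Corresponds D D' X := by
  classical
  have hp : p ∉ Set.range f := by simp [hf]
  have hq : q ∉ Set.range f := by simp [hf]
  have hnew : ∀ w, w ∉ Set.range (Node.map (n := n) f g) →
      w ∈ ([.over p', .over q'] : List D'.Nodes) ∨ w ∈ ([.under p, .under q] : List D'.Nodes) := by
    intro w hw
    obtain ⟨k, hk, hw'⟩ := eq_of_notMem_range_map hg hw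
    have hk' : k = p ∨ k = q := by simpa [hf, or_iff_not_imp_left] using hk
    rcases hpq' with ⟨rfl, rfl⟩ | ⟨rfl, rfl⟩ <;> rcases hk' with rfl | rfl <;>
    rcases hw' with rfl | rfl <;> simp
  have hchain : ∀ (z : D.Nodes) (l : List D'.Nodes), l <:+: ins z →
      l.IsChain (fun a b => D'.next a = b) := fun z l hl =>
    (h.isChain z).infix (hl.trans (List.suffix_cons _ _).isInfix)
  have hox : [.over p', .over q'] <:+: ins x := by
    rcases hins with rfl | rfl
    · exact ⟨[], insertAt y [.under p, .under q] x, by simp [insertAt]⟩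
    · exact ⟨insertAt y [.under p, .under q] x, [], by simp [insertAt]⟩
  have huy : [.under p, .under q] <:+: ins y := by
    rcases hins with rfl | rfl
    · exact ⟨insertAt x [.over p', .over q'] y, [], by simp [insertAt]⟩
    · exact ⟨[], insertAt x [.over p', .over q'] y, by simp [insertAt]⟩
  have hu : D'.next (.under p) = .under q := by
    simpa only [List.isChain_cons_cons, List.isChain_singleton, and_true] using hchain _ _ huy
  have ho : D'.next (.over p') = .over q' := by
    simpa only [List.isChain_cons_cons, List.isChain_singleton, and_true] using hchain _ _ hox
  have hover : ∀ φ : D'.Coloring X, φ.1 (.over q) = φ.1 (.over p) := by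
    intro φ
    have : φ.1 (.over q') = φ.1 (D'.next.symm (.over q')) := φ.2 (.over q')
    rw [(Equiv.symm_apply_eq _).2 ho.symm] at this
    rcases hpq' with ⟨rfl, rfl⟩ | ⟨rfl, rfl⟩
    · exact this
    · exact this.symm
  have hiu := fun φ : D'.Coloring X => inert_under_pair D' φ hs (hover φ)
  have hio := fun φ : D'.Coloring X => inert_over_pair D' φ hs (hover φ) hu hpq'
  refine h.corresponds (fun φ z => ?_) (fun φ => ?_) (fun φ ψ hφψ w hw => ?_)
  · rcases hins with rfl | rfl
    · exact ((hio φ).insertAt x z).append ((hiu φ).insertAt y z)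
    · exact ((hiu φ).insertAt y z).append ((hio φ).insertAt x z)
  · let ψ : D'.Nodes → X
      | .under k => if k = p then signed (D'.positive p) (Rack.act' (φ.1 x)) (φ.1 y) else φ.1 y
      | _ => φ.1 x
    have hφ := fun z => h.map_injective.extend_apply φ.1 ψ z
    have hψ : ∀ w, w ∉ Set.range (Node.map (n := n) f g) → _ :=
      fun w hw => Function.extend_apply' φ.1 ψ w hw
    have hop : _ = φ.1 x := hψ (.over p) (fun hw => hp (over_mem_range_map.1 hw))
    have hoq : _ = φ.1 x := hψ (.over q) (fun hw => hq (over_mem_range_map.1 hw))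
    have hup := hψ (.under p) (fun hw => hp (under_mem_range_map.1 hw))
    have huq := hψ (.under q) (fun hw => hq (under_mem_range_map.1 hw))
    simp only [ψ, if_true, hpq.symm, if_false] at hup huq
    set φ' := Function.extend (Node.map f g) φ.1 ψ
    have hop' : φ' (.over p') = φ.1 x := by rcases hpq' with ⟨rfl, rfl⟩ | ⟨rfl, rfl⟩ <;> assumption
    have hoq' : φ' (.over q') = φ.1 x := by rcases hpq' with ⟨rfl, rfl⟩ | ⟨rfl, rfl⟩ <;> assumption
    have hfo : D'.Fits φ' (φ.1 x) [.over p', .over q'] := by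
      intro r hr hc
      simp only [List.isChain_cons_cons] at hr
      refine ⟨hoq', ?_⟩
      simp only [List.mem_cons, List.not_mem_nil, or_false, forall_eq_or_imp, forall_eq, ColorsAt,
        (Equiv.symm_apply_eq D'.next).2 hr.1.symm, (Equiv.symm_apply_eq D'.next).2 hr.2.1.symm,
        hop', hoq', hc, and_self]
    have hfu : D'.Fits φ' (φ.1 y) [.under p, .under q] := by
      intro r hr hc
      simp only [List.isChain_cons_cons] at hr
      refine ⟨huq, ?_⟩
      simp only [List.mem_cons, List.not_mem_nil, or_false, forall_eq_or_imp, forall_eq, ColorsAt,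
        (Equiv.symm_apply_eq D'.next).2 hr.1.symm, (Equiv.symm_apply_eq D'.next).2 hr.2.1.symm,
        hop, hoq, hup, huq, hc, true_and]
      rw [signed_eq_iff, hs, Bool.not_not]
    have hfits : ∀ z, D'.Fits φ' (φ.1 z) (ins z) := by
      intro z
      rcases hins with rfl | rfl
      · exact (hfo.insertAt z).append (hfu.insertAt z)
      · exact (hfu.insertAt z).append (hfo.insertAt z)
    refine ⟨φ', hφ, fun z => ?_, fun w hw => ?_⟩
    · rw [h.symm_next_map, hφ]
      exact (hfits _ _ (h.isChain _) (hφ _)).1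
    · rcases hnew w hw with hw | hw
      · exact (hfits _ _ (h.isChain _) (hφ _)).2 w (hox.subset hw)
      · exact (hfits _ _ (h.isChain _) (hφ _)).2 w (huy.subset hw)
  · have key : ∀ φ : D'.Coloring X,
        φ.1 (.over p') = φ.1 (Node.map f g x) ∧ φ.1 (.over q') = φ.1 (Node.map f g x) ∧
        φ.1 (.under p) = signed (D'.positive p) (Rack.act' (φ.1 (Node.map f g x)))
          (φ.1 (Node.map f g y)) ∧ φ.1 (.under q) = φ.1 (Node.map f g y) := by
      intro φ
      obtain ⟨r, hr, hr'⟩ : ∃ r, φ.1 r = φ.1 (Node.map f g x) ∧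
          (r :: [.over p', .over q']).IsChain (fun a b => D'.next a = b) := by
        have hx := h.isChain x
        rcases hins with rfl | rfl
        · refine Inert.exists_chain (D'.inert_nil φ.1) (B := insertAt y [.under p, .under q] x) ?_
          simpa [insertAt] using hx
        · refine Inert.exists_chain ((hiu φ).insertAt y x) (B := []) ?_
          simpa [insertAt] using hx
      obtain ⟨s, hs, hs'⟩ : ∃ r, φ.1 r = φ.1 (Node.map f g y) ∧
          (r :: [.under p, .under q]).IsChain (fun a b => D'.next a = b) := by
        have hx := h.isChain y
        rcases hins with rfl | rfl
        · refine Inert.exists_chain ((hio φ).insertAt x y) (B := []) ?_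
          simpa [insertAt] using hx
        · refine Inert.exists_chain (D'.inert_nil φ.1) (B := insertAt x [.over p', .over q'] y) ?_
          simpa [insertAt] using hx
      have h1 : φ.1 (.over q') = _ := ((hio φ) r hr').1.trans hr
      have h2 : φ.1 (.under q) = _ := ((hiu φ) s hs').1.trans hs
      have h3 : φ.1 (.over p') = φ.1 (D'.next.symm (.over p')) := φ.2 (.over p')
      have h4 : φ.1 (.under p) = signed (D'.positive p) (Rack.act' (φ.1 (.over p)))
        (φ.1 (D'.next.symm (.under p))) := φ.2 (.under p)
      simp only [List.isChain_cons_cons] at hr' hs'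
      rw [(Equiv.symm_apply_eq _).2 hr'.1.symm, hr] at h3
      have h5 : φ.1 (.over p) = φ.1 (Node.map f g x) := by
        rcases hpq' with ⟨rfl, rfl⟩ | ⟨rfl, rfl⟩ <;> assumption
      rw [(Equiv.symm_apply_eq _).2 hs'.1.symm, hs, h5] at h4
      exact ⟨h3, h1, h4, h2⟩
    obtain ⟨a1, a2, a3, a4⟩ := key φ
    obtain ⟨b1, b2, b3, b4⟩ := key ψ
    rcases hnew w hw with hw | hw <;> simp only [List.mem_cons, List.not_mem_nil, or_false] at hw <;>
    rcases hw with rfl | rfl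
    · rw [a1, b1, hφψ]
    · rw [a2, b2, hφψ]
    · rw [a3, b3, hφψ, hφψ]
    · rw [a4, b4, hφψ]

end SecondMove

end Diagram

theorem signed_conj {G : Type*} [Group G] (b : Bool) (g x : G) :
    signed b (g * x * g⁻¹) = g * signed b x * g⁻¹ := by
  cases b
  · simp [mul_assoc]
  · rfl

namespace Diagram

/-! ### Reidemeister III: the combinatorics of the triangle -/

section ThirdMove

variable {n : ℕ} {X : Type u} [Quandle X]

/-- A Reidemeister III move, described by the bijection `ψ` of edges. -/
structure TriangleMove (D D' : Diagram n) (ψ : D.Nodes ≃ D'.Nodes) (f : D.Crossing ≃ D'.Crossing)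
    (g : D.Point ≃ D'.Point) (a b c : D.Crossing) (top mid bot : Bool) : Prop where
  hab : a ≠ b
  hac : a ≠ c
  hbc : b ≠ c
  next_apply : ∀ x, D'.next (ψ x) = ψ (D.next x)
  positive_eq : ∀ k, D'.positive (f k) = D.positive k
  over_a : ψ (.over a) = .over (f b)
  over_b : ψ (.over b) = .over (f a)
  under_a : ψ (.under a) = .over (f c)
  over_c : ψ (.over c) = .under (f a)
  under_b : ψ (.under b) = .under (f c)
  under_c : ψ (.under c) = .under (f b)
  over_of_ne : ∀ k, k ≠ a → k ≠ b → k ≠ c → ψ (.over k) = .over (f k)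
  under_of_ne : ∀ k, k ≠ a → k ≠ b → k ≠ c → ψ (.under k) = .under (f k)
  pt : ∀ m, ψ (.pt m) = .pt (g m)
  inf : ∀ i, ψ (.inf i) = .inf i
  htop : D.Consecutive top (.over a) (.over b)
  hmid : D.Consecutive mid (.under a) (.over c)
  hbot : D.Consecutive bot (.under b) (.under c)
  hs₁ : (D.positive a ^^ top ^^ mid) = (D.positive b ^^ top ^^ bot)
  hs₂ : (D.positive a ^^ top ^^ mid) = (D.positive c ^^ mid ^^ bot)

namespace TriangleMove

variable {D D' : Diagram n} {ψ : D.Nodes ≃ D'.Nodes} {f : D.Crossing ≃ D'.Crossing}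
  {g : D.Point ≃ D'.Point} {a b c : D.Crossing} {top mid bot : Bool}

theorem consecutive_map (t : TriangleMove D D' ψ f g a b c top mid bot) {v : Bool} {x y : D.Nodes}
    (h : D.Consecutive v x y) : D'.Consecutive (!v) (ψ y) (ψ x) := by
  cases v
  · exact (t.next_apply y).trans (congrArg ψ h)
  · exact (t.next_apply x).trans (congrArg ψ h)

theorem symm_next_apply (t : TriangleMove D D' ψ f g a b c top mid bot) (x : D.Nodes) :
    D'.next.symm (ψ x) = ψ (D.next.symm x) := by
  rw [Equiv.symm_apply_eq, t.next_apply, Equiv.apply_symm_apply]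

/-- The inverse move has the same form; since each strand meets its two crossings in the opposite
order after the move, all three Booleans are negated. -/
theorem symm (t : TriangleMove D D' ψ f g a b c top mid bot) :
    TriangleMove D' D ψ.symm f.symm g.symm (f a) (f b) (f c) (!top) (!mid) (!bot) where
  hab := f.injective.ne t.hab
  hac := f.injective.ne t.hac
  hbc := f.injective.ne t.hbc
  next_apply x := by rw [Equiv.eq_symm_apply, ← t.next_apply, Equiv.apply_symm_apply]
  positive_eq k := by rw [← t.positive_eq, Equiv.apply_symm_apply]
  over_a := by rw [Equiv.symm_apply_eq, Equiv.symm_apply_apply, t.over_b]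
  over_b := by rw [Equiv.symm_apply_eq, Equiv.symm_apply_apply, t.over_a]
  under_a := by rw [Equiv.symm_apply_eq, Equiv.symm_apply_apply, t.over_c]
  over_c := by rw [Equiv.symm_apply_eq, Equiv.symm_apply_apply, t.under_a]
  under_b := by rw [Equiv.symm_apply_eq, Equiv.symm_apply_apply, t.under_c]
  under_c := by rw [Equiv.symm_apply_eq, Equiv.symm_apply_apply, t.under_b]
  over_of_ne k h1 h2 h3 := by
    rw [Equiv.symm_apply_eq, t.over_of_ne, Equiv.apply_symm_apply] <;>
    rwa [ne_eq, Equiv.symm_apply_eq]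
  under_of_ne k h1 h2 h3 := by
    rw [Equiv.symm_apply_eq, t.under_of_ne, Equiv.apply_symm_apply] <;>
    rwa [ne_eq, Equiv.symm_apply_eq]
  pt m := by rw [Equiv.symm_apply_eq, t.pt, Equiv.apply_symm_apply]
  inf i := by rw [Equiv.symm_apply_eq, t.inf]
  htop := by
    have := t.consecutive_map t.htop
    rwa [t.over_a, t.over_b] at this
  hmid := by
    have := t.consecutive_map t.hmid
    rwa [t.under_a, t.over_c] at this
  hbot := by
    have := t.consecutive_map t.hbot
    rwa [t.under_b, t.under_c] at this
  hs₁ := by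
    have := t.hs₁
    rw [t.positive_eq, t.positive_eq]
    revert this
    generalize D.positive a = pa
    generalize D.positive b = pb
    revert pa pb
    cases top <;> cases mid <;> cases bot <;> decide
  hs₂ := by
    have := t.hs₂
    rw [t.positive_eq, t.positive_eq]
    revert this
    generalize D.positive a = pa
    generalize D.positive c = pc
    revert pa pc
    cases top <;> cases mid <;> cases bot <;> decide

/-- The inner edge of the middle strand. -/
def midEdge (a c : D.Crossing) (mid : Bool) : D.Nodes := cond mid (.under a) (.over c)

/-- The node at the end of the inner edge of the middle strand. -/
def midEnd (a c : D.Crossing) (mid : Bool) : D.Nodes := cond mid (.over c) (.under a)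

/-- The inner edge of the bottom strand. -/
def botEdge (b c : D.Crossing) (bot : Bool) : D.Nodes := cond bot (.under b) (.under c)

/-- The node at the end of the inner edge of the bottom strand. -/
def botEnd (b c : D.Crossing) (bot : Bool) : D.Nodes := cond bot (.under c) (.under b)

/-- The inner edge of the top strand. -/
def topEdge (a b : D.Crossing) (top : Bool) : D.Nodes := cond top (.over a) (.over b)

/-- The node at the end of the inner edge of the top strand. -/
def topEnd (a b : D.Crossing) (top : Bool) : D.Nodes := cond top (.over b) (.over a)

theorem next_midEdge (t : TriangleMove D D' ψ f g a b c top mid bot) :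
    D.next (midEdge a c mid) = midEnd a c mid := by
  have := t.hmid
  cases mid <;> exact this

theorem next_botEdge (t : TriangleMove D D' ψ f g a b c top mid bot) :
    D.next (botEdge b c bot) = botEnd b c bot := by
  have := t.hbot
  cases bot <;> exact this

theorem next_topEdge (t : TriangleMove D D' ψ f g a b c top mid bot) :
    D.next (topEdge a b top) = topEnd a b top := by
  have := t.htop
  cases top <;> exact this

/-- A colouring is determined by the colours outside of the triangle. -/
theorem eq_of_eq_outside (t : TriangleMove D D' ψ f g a b c top mid bot) (φ χ : D.Coloring X)
    (h : ∀ z, z ≠ midEdge a c mid → z ≠ botEdge b c bot → φ.1 z = χ.1 z) : φ = χ := by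
  -- The edges entering the triangle are outer edges, so the inner colours can be computed from
  -- outer ones: the middle strand first, then the bottom strand.
  have hmid : D.next.symm (midEdge a c mid) ≠ midEdge a c mid ∧
      D.next.symm (midEdge a c mid) ≠ botEdge b c bot := by
    rw [ne_eq, ne_eq, Equiv.symm_apply_eq, Equiv.symm_apply_eq, t.next_midEdge, t.next_botEdge]
    have := t.hab
    have := t.hac
    cases mid <;> cases bot <;> simp [midEdge, midEnd, botEnd, *]
  have hbot : D.next.symm (botEdge b c bot) ≠ midEdge a c mid ∧
      D.next.symm (botEdge b c bot) ≠ botEdge b c bot := by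
    rw [ne_eq, ne_eq, Equiv.symm_apply_eq, Equiv.symm_apply_eq, t.next_midEdge, t.next_botEdge]
    have := t.hab
    have := t.hac
    have := t.hbc
    cases mid <;> cases bot <;> simp [midEnd, botEdge, botEnd, *, Ne.symm, eq_comm]
  have hover : ∀ k, k ≠ c → φ.1 (.over k) = χ.1 (.over k) := by
    intro k hk
    refine h _ ?_ ?_
    · cases mid <;> simp [midEdge, hk]
    · cases bot <;> simp [botEdge]
  have hM : φ.1 (midEdge a c mid) = χ.1 (midEdge a c mid) := by
    have h1 := φ.2 (midEdge a c mid)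
    have h2 := χ.2 (midEdge a c mid)
    have h3 := h _ hmid.1 hmid.2
    have h4 := hover a t.hac
    cases mid <;> simp only [midEdge, cond_true, cond_false, ColorsAt] at h1 h2 h3 ⊢
    · rw [h1, h2, h3]
    · rw [h1, h2, h3, h4]
  have hover' : ∀ k, φ.1 (.over k) = χ.1 (.over k) := by
    intro k
    by_cases hk : k = c
    · subst hk
      cases mid
      · exact hM
      · refine h _ (by simp [midEdge]) ?_
        cases bot <;> simp [botEdge]
    · exact hover k hk
  have hB : φ.1 (botEdge b c bot) = χ.1 (botEdge b c bot) := by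
    have h1 := φ.2 (botEdge b c bot)
    have h2 := χ.2 (botEdge b c bot)
    have h3 := h _ hbot.1 hbot.2
    cases bot <;> simp only [botEdge, cond_true, cond_false, ColorsAt] at h1 h2 h3 ⊢ <;>
    rw [h1, h2, h3, hover']
  refine Subtype.ext (funext fun z => ?_)
  by_cases h1 : z = midEdge a c mid
  · rw [h1, hM]
  by_cases h2 : z = botEdge b c bot
  · rw [h2, hB]
  exact h z h1 h2

end TriangleMove

end ThirdMove

/-! ### Reidemeister III: recolouring the triangle -/

section ThirdMove

variable {n : ℕ} {X : Type u} [Quandle X]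

namespace TriangleMove

variable {D D' : Diagram n} {ψ : D.Nodes ≃ D'.Nodes} {f : D.Crossing ≃ D'.Crossing}
  {g : D.Point ≃ D'.Point} {a b c : D.Crossing} {top mid bot : Bool}

/-- The colours at a triangle, in terms of the colours `t`, `m₀`, `b₀` of the outer edges at the
crossings `a` and `b`; `v` and `w` are the signs of the crossings for suitably oriented strands. -/
theorem exists_colors (t : TriangleMove D D' ψ f g a b c top mid bot) (φ : D.Coloring X) :
    ∃ (v w : Bool) (m₀ m₁ b₀ b₁ b₂ : X),
      D.positive a = (v == mid) ∧ D.positive b = (v == bot) ∧ D.positive c = (w == bot) ∧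
      top = (w == (v == mid)) ∧
      m₁ = signed v (Rack.act' (φ.1 (.over a))) m₀ ∧
      b₁ = signed v (Rack.act' (φ.1 (.over a))) b₀ ∧ b₂ = signed w (Rack.act' m₁) b₁ ∧
      φ.1 (D.next.symm (.under a)) = cond mid m₀ m₁ ∧ φ.1 (.under a) = cond mid m₁ m₀ ∧
      φ.1 (D.next.symm (.over c)) = m₁ ∧ φ.1 (.over c) = m₁ ∧
      φ.1 (D.next.symm (.under b)) = cond bot b₀ b₁ ∧ φ.1 (.under b) = cond bot b₁ b₀ ∧
      φ.1 (D.next.symm (.under c)) = cond bot b₁ b₂ ∧ φ.1 (.under c) = cond bot b₂ b₁ ∧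
      φ.1 (.over b) = φ.1 (.over a) ∧ φ.1 (D.next.symm (.over a)) = φ.1 (.over a) ∧
      φ.1 (D.next.symm (.over b)) = φ.1 (.over a) := by
  have ha : φ.1 (.over a) = φ.1 (D.next.symm (.over a)) := φ.2 (.over a)
  have hb : φ.1 (.over b) = φ.1 (D.next.symm (.over b)) := φ.2 (.over b)
  have hc : φ.1 (.over c) = φ.1 (D.next.symm (.over c)) := φ.2 (.over c)
  have hua : φ.1 (.under a) = signed (D.positive a) (Rack.act' (φ.1 (.over a)))
    (φ.1 (D.next.symm (.under a))) := φ.2 (.under a)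
  have hub : φ.1 (.under b) = signed (D.positive b) (Rack.act' (φ.1 (.over b)))
    (φ.1 (D.next.symm (.under b))) := φ.2 (.under b)
  have huc : φ.1 (.under c) = signed (D.positive c) (Rack.act' (φ.1 (.over c)))
    (φ.1 (D.next.symm (.under c))) := φ.2 (.under c)
  have hba : φ.1 (.over b) = φ.1 (.over a) := by
    have := t.htop
    cases top
    · rw [ha, (Equiv.symm_apply_eq D.next).2 (Eq.symm this)]
    · rw [hb, (Equiv.symm_apply_eq D.next).2 (Eq.symm this)]
  have hmid := (Equiv.symm_apply_eq D.next).2 t.next_midEdge.symm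
  have hbot := (Equiv.symm_apply_eq D.next).2 t.next_botEdge.symm
  have hs₁ := t.hs₁
  have hs₂ := t.hs₂
  rw [hba] at hub
  refine ⟨D.positive a == mid, D.positive c == bot,
    φ.1 (cond mid (D.next.symm (.under a)) (.under a)), φ.1 (.over c),
    φ.1 (cond bot (D.next.symm (.under b)) (.under b)),
    φ.1 (cond bot (.under b) (D.next.symm (.under b))),
    φ.1 (cond bot (.under c) (D.next.symm (.under c))), ?_, ?_, ?_, ?_, ?_, ?_, ?_, ?_, ?_, hc.symm,
    rfl, ?_, ?_, ?_, ?_, hba, ha.symm, hb.symm.trans hba⟩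
  · generalize D.positive a = pa
    cases pa <;> cases mid <;> rfl
  · revert hs₁
    generalize D.positive a = pa
    generalize D.positive b = pb
    revert pa pb
    cases top <;> cases mid <;> cases bot <;> decide
  · generalize D.positive c = pc
    cases pc <;> cases bot <;> rfl
  · revert hs₂
    generalize D.positive a = pa
    generalize D.positive c = pc
    revert pa pc
    cases top <;> cases mid <;> cases bot <;> decide
  · cases mid <;> simp only [midEdge, midEnd, cond_true, cond_false] at hmid ⊢
    · rw [hmid, signed_eq_iff] at hua
      simpa using hua
    · rw [hc, hmid, hua]
      simp
  · have hpb : D.positive b = ((D.positive a == mid) == bot) := by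
      revert hs₁
      generalize D.positive a = pa
      generalize D.positive b = pb
      revert pa pb
      cases top <;> cases mid <;> cases bot <;> decide
    rw [hpb] at hub
    cases bot <;> simp only [cond_true, cond_false]
    · rw [signed_eq_iff] at hub
      simpa using hub
    · simpa using hub
  · cases bot <;> simp only [botEdge, botEnd, cond_true, cond_false] at hbot ⊢
    · rw [hbot]
      rw [signed_eq_iff] at huc
      simpa using huc
    · rw [huc, hbot]
      simp
  · cases mid
    · exact congrArg φ.1 hmid
    · rfl
  · cases mid
    · rfl
    · exact (hc.trans (congrArg φ.1 hmid)).symm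
  · cases bot <;> rfl
  · cases bot <;> rfl
  · cases bot
    · rfl
    · exact congrArg φ.1 hbot
  · cases bot
    · exact (congrArg φ.1 hbot).symm
    · rfl

/-- Only the inner edges of the middle and bottom strands are recoloured; self-distributivity makes
the result fit the outer edges. Single transports inside the triangle may change, but on each strand
the product of the two does not. -/
theorem exists_coloring (t : TriangleMove D D' ψ f g a b c top mid bot) (φ : D.Coloring X) :
    ∃ φ' : D'.Coloring X,
      (∀ z, z ≠ midEdge a c mid → z ≠ botEdge b c bot → φ'.1 (ψ z) = φ.1 z) ∧
      (∀ z, z ≠ topEdge a b top → z ≠ topEnd a b top → z ≠ midEdge a c mid → z ≠ midEnd a c mid →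
        z ≠ botEdge b c bot → z ≠ botEnd b c bot →
        D'.transport Rack.act' φ'.1 (ψ z) = D.transport Rack.act' φ.1 z) ∧
      D'.transport Rack.act' φ'.1 (ψ (topEnd a b top)) *
          D'.transport Rack.act' φ'.1 (ψ (topEdge a b top)) =
        D.transport Rack.act' φ.1 (topEnd a b top) * D.transport Rack.act' φ.1 (topEdge a b top) ∧
      D'.transport Rack.act' φ'.1 (ψ (midEnd a c mid)) *
          D'.transport Rack.act' φ'.1 (ψ (midEdge a c mid)) =
        D.transport Rack.act' φ.1 (midEnd a c mid) * D.transport Rack.act' φ.1 (midEdge a c mid) ∧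
      D'.transport Rack.act' φ'.1 (ψ (botEnd b c bot)) *
          D'.transport Rack.act' φ'.1 (ψ (botEdge b c bot)) =
        D.transport Rack.act' φ.1 (botEnd b c bot) * D.transport Rack.act' φ.1 (botEdge b c bot) := by
  classical
  obtain ⟨v, w, m₀, m₁, b₀, b₁, b₂, hpa, hpb, hpc, htop, hm₁, hb₁, hb₂, a1, a2, c1, c2, b1, b2, d1,
    d2, t1, t2, t3⟩ := t.exists_colors φ
  set T := φ.1 (.over a) with hT
  have hab := t.hab
  have hac := t.hac
  have hbc := t.hbc
  -- The new inner colour of the bottom strand, which now crosses below the middle strand where the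
  -- latter still has its colour `m₀`.
  let bs := signed w (Rack.act' m₀) b₀
  have am₁ : Rack.act' m₁ = signed v (Rack.act' T) * Rack.act' m₀ * (signed v (Rack.act' T))⁻¹ := by
    rw [hm₁, map_signed_act (fun _ _ => Rack.ad_conj _ _)]
  have ab₁ : Rack.act' b₁ = signed v (Rack.act' T) * Rack.act' b₀ * (signed v (Rack.act' T))⁻¹ := by
    rw [hb₁, map_signed_act (fun _ _ => Rack.ad_conj _ _)]
  have ab₂ : Rack.act' b₂ = signed w (Rack.act' m₁) * Rack.act' b₁ * (signed w (Rack.act' m₁))⁻¹ := by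
    rw [hb₂, map_signed_act (fun _ _ => Rack.ad_conj _ _)]
  have abs : Rack.act' bs = signed w (Rack.act' m₀) * Rack.act' b₀ * (signed w (Rack.act' m₀))⁻¹ :=
    map_signed_act (fun _ _ => Rack.ad_conj _ _) _ _ _
  -- Self-distributivity in signed form: passing below top and then middle agrees with passing below
  -- middle and then top.
  have hbs : b₂ = signed v (Rack.act' T) bs := by
    rw [hb₂, am₁, hb₁, signed_conj]
    simp [bs]
  let χ : D.Nodes → X := fun z =>
    if z = midEdge a c mid then m₀ else if z = botEdge b c bot then bs else φ.1 z
  have hχ : ∀ z, z ≠ midEdge a c mid → z ≠ botEdge b c bot → χ z = φ.1 z := by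
    intro z h1 h2
    simp [χ, h1, h2]
  have hχp : ∀ z, χ (D.next.symm z) =
      if z = midEnd a c mid then m₀ else if z = botEnd b c bot then bs else
        φ.1 (D.next.symm z) := by
    intro z
    simp only [χ, Equiv.symm_apply_eq, t.next_midEdge, t.next_botEdge]
  have e1 : χ (.over a) = T := by
    rw [hT]
    apply hχ
    · cases mid <;> simp [midEdge, hac]
    · cases bot <;> simp [botEdge]
  have e2 : χ (.over b) = T := by
    rw [← t1]
    apply hχ
    · cases mid <;> simp [midEdge, hbc]
    · cases bot <;> simp [botEdge]
  have e3 : χ (D.next.symm (.over a)) = T := by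
    rw [hχp, ← t2]
    cases mid <;> cases bot <;> simp [midEnd, botEnd, hac]
  have e4 : χ (D.next.symm (.over b)) = T := by
    rw [hχp, ← t3]
    cases mid <;> cases bot <;> simp [midEnd, botEnd, hbc]
  have e5 : χ (.under a) = m₀ := by
    cases mid <;> cases bot <;> simp [χ, midEdge, botEdge, hab, hac, a2]
  have e6 : χ (D.next.symm (.under a)) = m₀ := by
    rw [hχp]
    cases mid <;> cases bot <;> simp [midEnd, botEnd, hab, hac, a1]
  have e7 : χ (.over c) = cond mid m₁ m₀ := by
    cases mid <;> cases bot <;> simp [χ, midEdge, botEdge, c2]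
  have e8 : χ (D.next.symm (.over c)) = cond mid m₀ m₁ := by
    rw [hχp]
    cases mid <;> cases bot <;> simp [midEnd, botEnd, c1]
  have e9 : χ (.under b) = cond bot bs b₀ := by
    cases mid <;> cases bot <;> simp [χ, midEdge, botEdge, hab.symm, hbc, b2]
  have e10 : χ (D.next.symm (.under b)) = cond bot b₀ bs := by
    rw [hχp]
    cases mid <;> cases bot <;> simp [midEnd, botEnd, hab.symm, hbc, b1]
  have e11 : χ (.under c) = cond bot b₂ bs := by
    cases mid <;> cases bot <;> simp [χ, midEdge, botEdge, hac.symm, hbc.symm, d2]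
  have e12 : χ (D.next.symm (.under c)) = cond bot bs b₂ := by
    rw [hχp]
    cases mid <;> cases bot <;> simp [midEnd, botEnd, hac.symm, hbc.symm, d1]
  have o1 : ∀ k, k ≠ a → k ≠ b → k ≠ c → χ (.over k) = φ.1 (.over k) ∧
      χ (.under k) = φ.1 (.under k) ∧
      χ (D.next.symm (.over k)) = φ.1 (D.next.symm (.over k)) ∧
      χ (D.next.symm (.under k)) = φ.1 (D.next.symm (.under k)) := by
    intro k h1 h2 h3
    rw [hχp, hχp]
    cases mid <;> cases bot <;> simp [χ, midEdge, botEdge, midEnd, botEnd, h1, h2, h3]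
  have o2 : ∀ m, χ (.pt m) = φ.1 (.pt m) ∧
      χ (D.next.symm (.pt m)) = φ.1 (D.next.symm (.pt m)) := by
    intro m
    rw [hχp]
    cases mid <;> cases bot <;> simp [χ, midEdge, botEdge, midEnd, botEnd]
  let φ' : D'.Nodes → X := fun w => χ (ψ.symm w)
  have hφ' : ∀ z, φ' (ψ z) = χ z := fun z => congrArg χ (ψ.symm_apply_apply z)
  have hφp : ∀ z, φ' (D'.next.symm (ψ z)) = χ (D.next.symm z) := fun z => by
    rw [t.symm_next_apply, hφ']
  have g1 := (congrArg φ' t.over_a).symm.trans ((hφ' _).trans e1)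
  have g2 := (congrArg φ' t.over_b).symm.trans ((hφ' _).trans e2)
  have g3 := (congrArg (fun w => φ' (D'.next.symm w)) t.over_a).symm.trans ((hφp _).trans e3)
  have g4 := (congrArg (fun w => φ' (D'.next.symm w)) t.over_b).symm.trans ((hφp _).trans e4)
  have g5 := (congrArg φ' t.under_a).symm.trans ((hφ' _).trans e5)
  have g6 := (congrArg (fun w => φ' (D'.next.symm w)) t.under_a).symm.trans ((hφp _).trans e6)
  have g7 := (congrArg φ' t.over_c).symm.trans ((hφ' _).trans e7)
  have g8 := (congrArg (fun w => φ' (D'.next.symm w)) t.over_c).symm.trans ((hφp _).trans e8)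
  have g9 := (congrArg φ' t.under_b).symm.trans ((hφ' _).trans e9)
  have g10 := (congrArg (fun w => φ' (D'.next.symm w)) t.under_b).symm.trans ((hφp _).trans e10)
  have g11 := (congrArg φ' t.under_c).symm.trans ((hφ' _).trans e11)
  have g12 := (congrArg (fun w => φ' (D'.next.symm w)) t.under_c).symm.trans ((hφp _).trans e12)
  have o3 : ∀ k, k ≠ a → k ≠ b → k ≠ c → φ' (.over (f k)) = φ.1 (.over k) ∧
      φ' (.under (f k)) = φ.1 (.under k) ∧
      φ' (D'.next.symm (.over (f k))) = φ.1 (D.next.symm (.over k)) ∧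
      φ' (D'.next.symm (.under (f k))) = φ.1 (D.next.symm (.under k)) := by
    intro k h1 h2 h3
    rw [← t.over_of_ne k h1 h2 h3, ← t.under_of_ne k h1 h2 h3, hφ', hφ', hφp, hφp]
    exact o1 k h1 h2 h3
  have hcol : ∀ w, D'.ColorsAt φ' w := by
    intro w
    obtain ⟨z, rfl⟩ := ψ.surjective w
    rcases z with k | k | m | i
    · by_cases h1 : k = a
      · rw [h1, t.over_a]
        exact g1.trans g3.symm
      by_cases h2 : k = b
      · rw [h2, t.over_b]
        exact g2.trans g4.symm
      by_cases h3 : k = c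
      · rw [h3, t.over_c]
        simp only [ColorsAt, g7, g2, g8, t.positive_eq, hpa]
        cases mid
        · rw [signed_eq_iff, hm₁]
          simp
        · simpa using hm₁
      · obtain ⟨h4, -, h5, -⟩ := o3 k h1 h2 h3
        rw [t.over_of_ne k h1 h2 h3]
        exact h4.trans ((φ.2 (.over k)).trans h5.symm)
    · by_cases h1 : k = a
      · rw [h1, t.under_a]
        exact g5.trans g6.symm
      by_cases h2 : k = b
      · rw [h2, t.under_b]
        simp only [ColorsAt, g9, g5, g10, t.positive_eq, hpc]
        cases bot
        · rw [signed_eq_iff]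
          simp [bs]
        · simp [bs]
      by_cases h3 : k = c
      · rw [h3, t.under_c]
        simp only [ColorsAt, g11, g1, g12, t.positive_eq, hpb]
        cases bot
        · rw [signed_eq_iff, hbs]
          simp
        · simpa using hbs
      · obtain ⟨h4, h5, -, h6⟩ := o3 k h1 h2 h3
        rw [t.under_of_ne k h1 h2 h3]
        simp only [ColorsAt, h4, h5, h6, t.positive_eq]
        exact φ.2 (.under k)
    · have h1 := (hφ' (.pt m)).trans (o2 m).1
      have h2 := (hφp (.pt m)).trans (o2 m).2
      rw [t.pt] at h1 h2 ⊢
      exact h1.trans ((φ.2 (.pt m)).trans h2.symm)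
    · rw [t.inf]
      trivial
  refine ⟨⟨φ', hcol⟩, fun z h1 h2 => (hφ' z).trans (hχ z h1 h2), ?_, ?_, ?_, ?_⟩
  · intro z h1 h2 h3 h4 h5 h6
    rcases z with k | k | m | i
    · have ha : k ≠ a := by
        rintro rfl
        cases top <;> simp [topEdge, topEnd] at h1 h2
      have hb : k ≠ b := by
        rintro rfl
        cases top <;> simp [topEdge, topEnd] at h1 h2
      have hc : k ≠ c := by
        rintro rfl
        cases mid <;> simp [midEdge, midEnd] at h3 h4
      obtain ⟨-, h7, -, h8⟩ := o3 k ha hb hc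
      rw [t.over_of_ne k ha hb hc]
      simp only [transport, h7, h8, t.positive_eq]
    · have ha : k ≠ a := by
        rintro rfl
        cases mid <;> simp [midEdge, midEnd] at h3 h4
      have hb : k ≠ b := by
        rintro rfl
        cases bot <;> simp [botEdge, botEnd] at h5 h6
      have hc : k ≠ c := by
        rintro rfl
        cases bot <;> simp [botEdge, botEnd] at h5 h6
      rw [t.under_of_ne k ha hb hc]
      simp only [transport, (o3 k ha hb hc).1, t.positive_eq]
    · rw [t.pt]
      rfl
    · rw [t.inf]
      rfl
  · subst htop
    cases v <;> cases w <;> cases mid <;> cases bot <;>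
    simp [topEdge, topEnd, t.over_a, t.over_b, transport, t.positive_eq, hpa, hpb, g7, g8, g11, g12,
      a1, a2, b1, b2, ab₁, ab₂, am₁, abs, mul_assoc]
  · cases v <;> cases w <;> cases mid <;> cases bot <;>
    simp [midEdge, midEnd, t.under_a, t.over_c, transport, t.positive_eq, hpa, hpc, g2, g9, g10,
      d1, d2, ab₁, ab₂, am₁, abs, ← hT, mul_assoc]
  · cases v <;> cases w <;> cases mid <;> cases bot <;>
    simp [botEdge, botEnd, t.under_b, t.under_c, transport, t.positive_eq, hpb, hpc, g1, g5, t1, c2,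
      am₁, mul_assoc]

end TriangleMove

end ThirdMove

/-! ### Reidemeister III: invariance of colourings and transport -/

section ThirdMove

variable {n : ℕ} {X : Type u} [Quandle X]

namespace TriangleMove

variable {D D' : Diagram n} {ψ : D.Nodes ≃ D'.Nodes} {f : D.Crossing ≃ D'.Crossing}
  {g : D.Point ≃ D'.Point} {a b c : D.Crossing} {top mid bot : Bool}

/-- Equal products over the two passages of each strand mean that transport before and after the
move differs by a change of coordinates `ρ` supported on the three inner edges. As these are never
edges at an endpoint, transport between endpoints agrees. -/
theorem exists_gauge (t : TriangleMove D D' ψ f g a b c top mid bot) (φ : D.Coloring X) :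
    ∃ φ' : D'.Coloring X,
      (∀ z, z ≠ midEdge a c mid → z ≠ botEdge b c bot → φ'.1 (ψ z) = φ.1 z) ∧
      ∃ ρ : D.Nodes → Equiv.Perm X, (∀ i, ρ (.inf i) = 1) ∧ (∀ i, ρ (D.next.symm (.inf i)) = 1) ∧
        ∀ z, (∀ i, z ≠ .inf i) → D'.transport Rack.act' φ'.1 (ψ z) * ρ (D.next.symm z) =
          ρ z * D.transport Rack.act' φ.1 z := by
  classical
  obtain ⟨φ', h, h0, h1, h2, h3⟩ := t.exists_coloring φ
  let S : Set D.Nodes := {topEdge a b top, midEdge a c mid, botEdge b c bot}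
  -- On an inner edge `ρ` is the discrepancy caused by the first passage; the second passage removes
  -- it.
  let ρ : D.Nodes → Equiv.Perm X := fun z =>
    if z ∈ S then D'.transport Rack.act' φ'.1 (ψ z) * (D.transport Rack.act' φ.1 z)⁻¹ else 1
  have hprev : ∀ z, D.next.symm z ∈ S ↔
      z ∈ ({topEnd a b top, midEnd a c mid, botEnd b c bot} : Set D.Nodes) := by
    intro z
    simp only [S, Set.mem_insert_iff, Set.mem_singleton_iff, Equiv.symm_apply_eq, t.next_topEdge,
      t.next_midEdge, t.next_botEdge]
  have hdisj : ∀ z ∈ ({topEnd a b top, midEnd a c mid, botEnd b c bot} : Set D.Nodes), z ∉ S := by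
    have hab := t.hab
    have hac := t.hac
    have hbc := t.hbc
    rintro z (rfl | rfl | rfl) <;> cases top <;> cases mid <;> cases bot <;>
    simp [S, topEdge, topEnd, midEdge, midEnd, botEdge, botEnd, hab, hac, hbc, hab.symm, hac.symm,
      hbc.symm]
  refine ⟨φ', h, ρ, fun i => if_neg ?_, fun i => if_neg ?_, fun z hz => ?_⟩
  · cases top <;> cases mid <;> cases bot <;> simp [S, topEdge, midEdge, botEdge]
  · rw [hprev]
    cases top <;> cases mid <;> cases bot <;> simp [topEnd, midEnd, botEnd]
  · by_cases hE : D.next.symm z ∈ S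
    · have hz' := (hprev z).1 hE
      rw [show ρ (D.next.symm z) = _ from if_pos hE, show ρ z = 1 from if_neg (hdisj z hz'),
        ← mul_assoc, mul_inv_eq_iff_eq_mul, one_mul]
      rcases hz' with rfl | rfl | rfl
      · rwa [(Equiv.symm_apply_eq D.next).2 t.next_topEdge.symm]
      · rwa [(Equiv.symm_apply_eq D.next).2 t.next_midEdge.symm]
      · rwa [(Equiv.symm_apply_eq D.next).2 t.next_botEdge.symm]
    · rw [show ρ (D.next.symm z) = 1 from if_neg hE, mul_one]
      by_cases hS : z ∈ S
      · rw [show ρ z = _ from if_pos hS, inv_mul_cancel_right]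
      · rw [show ρ z = _ from if_neg hS, one_mul]
        rw [hprev] at hE
        simp only [S, Set.mem_insert_iff, Set.mem_singleton_iff, not_or] at hE hS
        exact h0 z hS.1 hE.1 hS.2.1 hE.2.1 hS.2.2 hE.2.2

theorem par_map (t : TriangleMove D D' ψ f g a b c top mid bot) {φ : D.Nodes → X}
    {φ' : D'.Nodes → X} {ρ : D.Nodes → Equiv.Perm X}
    (hρ : ∀ z, (∀ i, z ≠ .inf i) → D'.transport Rack.act' φ' (ψ z) * ρ (D.next.symm z) =
      ρ z * D.transport Rack.act' φ z) {p q : D.Nodes × X} (h : D.Par Rack.act' φ p q) :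
    D'.Par Rack.act' φ' (ψ p.1, ρ p.1 p.2) (ψ q.1, ρ q.1 q.2) := by
  induction h with
  | refl => exact .refl
  | @tail q r _ hqr ih =>
    obtain ⟨h1, h2, h3⟩ := hqr
    refine ih.tail ⟨?_, fun i hi => ?_, ?_⟩
    · exact (t.next_apply _).trans (congrArg ψ h1)
    · change ψ r.1 = .inf i at hi
      rw [← t.inf] at hi
      exact h2 i (ψ.injective hi)
    · have h4 := hρ r.1 h2
      rw [← h1, Equiv.symm_apply_apply, h1] at h4
      change ρ r.1 r.2 = D'.transport Rack.act' φ' (ψ r.1) (ρ q.1 q.2)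
      rw [h3, ← Equiv.Perm.mul_apply, ← h4, Equiv.Perm.mul_apply]

/-- Recolouring is bijective because colourings are determined outside of the triangle and the
inverse move recolours back. -/
theorem corresponds (t : TriangleMove D D' ψ f g a b c top mid bot) : Corresponds D D' X := by
  choose F hF ρ hρ₁ hρ₂ hρ using fun φ : D.Coloring X => t.exists_gauge φ
  have hmid : ψ (midEdge a c mid) = midEdge (f a) (f c) (!mid) := by
    cases mid
    · exact t.over_c
    · exact t.under_a
  have hbot : ψ (botEdge b c bot) = botEdge (f b) (f c) (!bot) := by
    cases bot
    · exact t.under_c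
    · exact t.under_b
  have hbij : Function.Bijective F := by
    constructor
    · intro φ χ h
      refine t.eq_of_eq_outside φ χ fun z h1 h2 => ?_
      rw [← hF φ z h1 h2, ← hF χ z h1 h2, h]
    · intro φ'
      obtain ⟨φ, hφ, -⟩ := t.symm.exists_gauge φ'
      refine ⟨φ, t.symm.eq_of_eq_outside _ _ fun w h1 h2 => ?_⟩
      have h3 := hφ w h1 h2
      rw [← h3, ← hF φ, Equiv.apply_symm_apply]
      · rwa [ne_eq, Equiv.symm_apply_eq, hmid]
      · rwa [ne_eq, Equiv.symm_apply_eq, hbot]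
  refine ⟨(Equiv.ofBijective F hbij).symm, fun φ' => ?_⟩
  obtain ⟨φ, rfl⟩ := hbij.2 φ'
  rw [show (Equiv.ofBijective F hbij).symm (F φ) = φ from
    (Equiv.ofBijective F hbij).symm_apply_apply φ]
  have hhead : ∀ i, D'.next.symm (.inf i) = ψ (D.next.symm (.inf i)) := fun i => by
    rw [← t.inf, t.symm_next_apply]
  refine ⟨fun i => ?_, fun i => ?_, fun i y y' h => ?_⟩
  · rw [← t.inf i]
    refine (hF φ _ ?_ ?_).symm
    · cases mid <;> simp [midEdge]
    · cases bot <;> simp [botEdge]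
  · rw [hhead]
    refine (hF φ _ ?_ ?_).symm
    · rw [ne_eq, Equiv.symm_apply_eq, t.next_midEdge]
      cases mid <;> simp [midEnd]
    · rw [ne_eq, Equiv.symm_apply_eq, t.next_botEdge]
      cases bot <;> simp [botEnd]
  · have := t.par_map (hρ φ) h
    simp only [hρ₁, hρ₂, Equiv.Perm.one_apply, t.inf] at this
    rwa [hhead]

end TriangleMove

theorem corresponds_triangle {D D' : Diagram n} {f : D.Crossing → D'.Crossing}
    {g : D.Point → D'.Point} (a b c : D.Crossing) (top mid bot : Bool)
    (hab : a ≠ b) (hac : a ≠ c) (hbc : b ≠ c)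
    (htop : D.Consecutive top (.over a) (.over b))
    (hmid : D.Consecutive mid (.under a) (.over c))
    (hbot : D.Consecutive bot (.under b) (.under c))
    (hs₁ : (D.positive a ^^ top ^^ mid) = (D.positive b ^^ top ^^ bot))
    (hs₂ : (D.positive a ^^ top ^^ mid) = (D.positive c ^^ mid ^^ bot))
    (hf : Function.Bijective f) (hg : Function.Bijective g)
    (hpos : ∀ k, D'.positive (f k) = D.positive k)
    (h : ∀ x, D'.next (Node.map f g (D.triangleSwap a b c x)) =
      Node.map f g (D.triangleSwap a b c (D.next x))) : Corresponds D D' X := by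
  classical
  have hmap : Function.Bijective (Node.map (n := n) f g) := by
    refine ⟨Node.map_injective hf.1 hg.1, ?_⟩
    rintro (k | k | m | i)
    · exact (hf.2 k).elim fun k hk => ⟨.over k, congrArg Node.over hk⟩
    · exact (hf.2 k).elim fun k hk => ⟨.under k, congrArg Node.under hk⟩
    · exact (hg.2 m).elim fun m hm => ⟨.pt m, congrArg Node.pt hm⟩
    · exact ⟨.inf i, rfl⟩
  let ψ : D.Nodes ≃ D'.Nodes := (D.triangleSwap a b c).trans (Equiv.ofBijective _ hmap)
  have t : TriangleMove D D' ψ (Equiv.ofBijective f hf) (Equiv.ofBijective g hg) a b c top mid bot :=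
    { hab := hab
      hac := hac
      hbc := hbc
      next_apply := h
      positive_eq := hpos
      over_a := by simp [ψ, triangleSwap, Equiv.swap_apply_def, Node.map, hac]
      over_b := by simp [ψ, triangleSwap, Equiv.swap_apply_def, Node.map, hbc]
      under_a := by simp [ψ, triangleSwap, Equiv.swap_apply_def, Node.map, hab, hac, hac.symm, hbc.symm]
      over_c := by simp [ψ, triangleSwap, Equiv.swap_apply_def, Node.map]
      under_b := by simp [ψ, triangleSwap, Equiv.swap_apply_def, Node.map, hac.symm]
      under_c := by simp [ψ, triangleSwap, Equiv.swap_apply_def, Node.map, hab.symm]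
      over_of_ne := by
        intro k h1 h2 h3
        simp [ψ, triangleSwap, Equiv.swap_apply_def, Node.map, h1, h2, h3]
      under_of_ne := by
        intro k h1 h2 h3
        simp [ψ, triangleSwap, Equiv.swap_apply_def, Node.map, h1, h2, h3]
      pt := by
        intro m
        simp [ψ, triangleSwap, Equiv.swap_apply_def, Node.map]
      inf := by
        intro i
        simp [ψ, triangleSwap, Equiv.swap_apply_def, Node.map]
      htop := htop
      hmid := hmid
      hbot := hbot
      hs₁ := hs₁
      hs₂ := hs₂ }
  exact t.corresponds

end ThirdMove

theorem Move.corresponds {n : ℕ} {X : Type u} [Quandle X] {D D' : Diagram n} (h : Move D D') :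
    Corresponds D D' X := by
  cases h with
  | relabel hf hg h => exact h.corresponds_relabel hf hg
  | point x m hf hg h => exact h.corresponds_point x m hf hg
  | r1 x k l hf hg hl h => exact h.corresponds_kink x k l hf hg hl
  | r2 x y k₁ k₂ l ins hk hs hf hg hl hins h =>
    rcases hl with rfl | rfl
    · exact h.corresponds_bigon x y k₁ k₂ k₁ k₂ hk (Bool.eq_not.2 hs.symm) hf hg
        (.inl ⟨rfl, rfl⟩) hins
    · exact h.corresponds_bigon x y k₂ k₁ k₁ k₂ hk.symm (Bool.eq_not.2 hs)
        (by rw [hf, Set.pair_comm]) hg (.inr ⟨rfl, rfl⟩) hins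
  | r3 a b c top mid bot hab hac hbc htop hmid hbot hs₁ hs₂ hf hg hpos h =>
    exact corresponds_triangle a b c top mid bot hab hac hbc htop hmid hbot hs₁ hs₂ hf hg hpos h

/-! ### Invariance of the closing condition, under moves and the under-closure -/

section Closure

variable {X : Type u} [Quandle X]

/-- The colourings of two 1-linkoid diagrams correspond to each other, with the same colours at the
endpoints and the same closing property. -/
def SameColorings (D D' : Diagram 1) (X : Type u) [Quandle X] : Prop :=
  ∃ e : D.Coloring X ≃ D'.Coloring X, ∀ φ,
    (e φ).leg = φ.leg ∧ (e φ).head = φ.head ∧ ((e φ).Closes ↔ φ.Closes)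

theorem Coloring.closes_iff_of_par [Finite X] {D : Diagram 1} (φ : D.Coloring X) {y : X}
    (h : D.Par Rack.act' φ.1 (.inf 0, φ.leg) (D.next.symm (.inf 0), y)) :
    φ.Closes ↔ y = φ.head :=
  φ.closes_iff ((D.CoverRel _ _).trans (h.coverRel _ φ.2) (D.coverRel_head _ _ 0 y))

theorem Corresponds.sameColorings [Finite X] {D D' : Diagram 1} (h : Corresponds D D' X) :
    SameColorings D D' X := by
  obtain ⟨e, he⟩ := h
  refine ⟨e.symm, fun φ => ?_⟩
  obtain ⟨ψ, rfl⟩ := e.surjective φ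
  rw [e.symm_apply_apply]
  obtain ⟨h1, h2, h3⟩ := he ψ
  have hl : ψ.leg = (e ψ).leg := (h1 0).symm
  have hh : ψ.head = (e ψ).head := (h2 0).symm
  refine ⟨hl, hh, ?_⟩
  obtain ⟨y, hy⟩ := D.exists_par Rack.act' (e ψ).1 (e ψ).leg
  have hy' := h3 0 _ _ hy
  rw [← hl] at hy'
  rw [ψ.closes_iff_of_par hy', (e ψ).closes_iff_of_par hy, hh]

theorem Equivalent.sameColorings [Finite X] {D D' : Diagram 1} (h : D.Equivalent D') :
    SameColorings D D' X := by
  induction h with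
  | rel _ _ h => exact h.corresponds.sameColorings
  | refl => exact ⟨Equiv.refl _, fun _ => ⟨rfl, rfl, Iff.rfl⟩⟩
  | symm _ _ _ ih =>
    obtain ⟨e, he⟩ := ih
    refine ⟨e.symm, fun φ => ?_⟩
    obtain ⟨h1, h2, h3⟩ := he (e.symm φ)
    rw [e.apply_symm_apply] at h1 h2 h3
    exact ⟨h1.symm, h2.symm, h3.symm⟩
  | trans _ _ _ _ _ ih ih' =>
    obtain ⟨e, he⟩ := ih
    obtain ⟨e', he'⟩ := ih'
    exact ⟨e.trans e', fun φ => ⟨(he' _).1.trans (he φ).1, (he' _).2.1.trans (he φ).2.1,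
      (he' _).2.2.trans (he φ).2.2⟩⟩

theorem Equivalent.card_coloring {n : ℕ} {D D' : Diagram n} (h : D.Equivalent D') :
    Nat.card (D.Coloring X) = Nat.card (D'.Coloring X) := by
  induction h with
  | rel _ _ h =>
    obtain ⟨e, -⟩ := h.corresponds (X := X)
    exact Nat.card_congr e.symm
  | refl => rfl
  | symm _ _ _ ih => exact ih.symm
  | trans _ _ _ _ _ ih ih' => exact ih.trans ih'

/-- The region of the head extends around the head to both sides of its edge, which has passed below
an edge at its last crossing. -/
theorem coverRel_around_head {n : ℕ} (D : Diagram n) (φ : D.Coloring X) {k : D.Crossing} {i : Fin n}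
    (hk : D.next (.under k) = .inf i) {Y : Type v} (a : X → Equiv.Perm Y) (y : Y) :
    D.CoverRel a φ.1 ((D.next.symm (.over k), true), y) ((.over k, true), y) := by
  have ho : φ.1 (D.next.symm (.over k)) = φ.1 (.over k) := (φ.2 (.over k)).symm
  have htip : ∀ y, D.CoverRel a φ.1 ((.under k, true), y) (D.rot (.under k, true), y) := by
    intro y
    have h1 := D.coverFace_rel a φ.1 (.under k, true) y
    have h2 := D.coverFace_rel a φ.1 (.inf i, false) y
    have h3 : D.next.symm (.inf i) = .under k := (Equiv.symm_apply_eq _).2 hk.symm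
    rw [show D.face (.under k, true) = (.inf i, false) by
      simp [GaussDiagram.face, GaussDiagram.flip, GaussDiagram.rot, hk]] at h1
    rw [show D.face (.inf i, false) = D.rot (.under k, true) by
      simp [GaussDiagram.face, GaussDiagram.flip, h3]] at h2
    exact (D.CoverRel a φ.1).trans h1 h2
  have h0 := D.coverFace_rel a φ.1 (D.next.symm (.over k), true) y
  cases hc : D.positive k
  · rw [show D.face (D.next.symm (.over k), true) = (.under k, true) by
      simp [GaussDiagram.face, GaussDiagram.flip, GaussDiagram.rot, hc]] at h0
    have h1 := htip y
    rw [show D.rot (.under k, true) = (.over k, true) by simp [GaussDiagram.rot, hc]] at h1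
    exact (D.CoverRel a φ.1).trans h0 h1
  · rw [show D.face (D.next.symm (.over k), true) = (.under k, false) by
      simp [GaussDiagram.face, GaussDiagram.flip, GaussDiagram.rot, hc]] at h0
    have h1 := htip (a (φ.1 (.over k)) y)
    rw [show D.rot (.under k, true) = (.over k, false) by simp [GaussDiagram.rot, hc]] at h1
    have h2 := D.coverRot_rel a φ.1 (.over k, true) y
    rw [show D.rot (.over k, true) = (.under k, true) by simp [GaussDiagram.rot, hc]] at h2
    have h3 := D.coverRot_rel a φ.1 (.over k, false) (a (φ.1 (.over k)) y)
    rw [show D.rot (.over k, false) = (.under k, false) by simp [GaussDiagram.rot, hc]] at h3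
    simp only [holonomy, ho, Equiv.Perm.inv_def, Equiv.symm_apply_apply] at h2 h3
    exact (D.CoverRel a φ.1).trans h0 ((D.CoverRel a φ.1).symm
      ((D.CoverRel a φ.1).trans h2 ((D.CoverRel a φ.1).trans h1 h3)))

/-- Moving the head below an edge preserves the colourings, the colour of the leg and the closing
property. -/
theorem UnderMove.exists_equiv [Finite X] {D D' : Diagram 1} (h : UnderMove D D') :
    ∃ e : D'.Coloring X ≃ D.Coloring X, ∀ φ, (e φ).Closes ↔ φ.Closes := by
  classical
  obtain @⟨f, g, x, k, hf, hg, h⟩ := h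
  set e₀ := D.next.symm (.inf 0) with he₀
  have hk : k ∉ Set.range f := by simp [hf]
  have hnew : ∀ w, w ∉ Set.range (Node.map (n := 1) f g) → w = .over k ∨ w = .under k := by
    intro w hw
    obtain ⟨k', hk', hw'⟩ := eq_of_notMem_range_map hg hw
    rw [hf, Set.mem_compl_iff, not_not, Set.mem_singleton_iff] at hk'
    rwa [hk'] at hw'
  have hover : D'.next.symm (.over k) = Node.map f g x := by
    have := h.isChain x
    simp only [insertAt, if_true, List.cons_append, List.isChain_cons_cons] at this
    exact (Equiv.symm_apply_eq _).2 this.1.symm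
  -- If the head is pushed below its own last edge, both passages of `k` lie on that edge, the
  -- over-passage first.
  have hunder : D'.next.symm (.under k) = if x = e₀ then .over k else Node.map f g e₀ := by
    have := h.isChain e₀
    split_ifs with hx
    · simp only [insertAt, hx, if_true, List.cons_append, List.isChain_cons_cons,
        List.nil_append] at this
      exact (Equiv.symm_apply_eq _).2 this.2.1.symm
    · simp only [insertAt, if_neg (Ne.symm hx), if_true, List.isChain_cons_cons,
        List.nil_append] at this
      exact (Equiv.symm_apply_eq _).2 this.1.symm
  have hinf : D'.next.symm (.inf 0) = .under k := by
    have := h.symm_next_map (.inf 0)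
    rw [show Node.map f g (.inf 0) = .inf 0 from rfl, ← he₀] at this
    rw [this]
    by_cases hx : e₀ = x <;> simp [insertAt, hx]
  have hprev : ∀ z, (∀ i, z ≠ .inf i) → D'.next.symm (Node.map f g z) =
      if D.next.symm z = x then .over k else Node.map f g (D.next.symm z) := by
    intro z hz
    have hz' : D.next.symm z ≠ e₀ := fun h => hz 0 (D.next.symm.injective h)
    rw [h.symm_next_map]
    split_ifs with hx
    · rw [hx] at hz'
      simp [insertAt, hx, hz']
    · simp only [insertAt, if_neg hz', if_neg hx, List.append_nil]
      rfl
  have hnext : D'.next (.under k) = .inf 0 := ((Equiv.symm_apply_eq _).1 hinf).symm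
  have hφo : ∀ φ : D'.Coloring X, φ.1 (.over k) = φ.1 (Node.map f g x) := by
    intro φ
    have : φ.1 (.over k) = φ.1 (D'.next.symm (.over k)) := φ.2 (.over k)
    rwa [hover] at this
  have hφu : ∀ φ : D'.Coloring X, φ.1 (.under k) =
      signed (D'.positive k) (Rack.act' (φ.1 (Node.map f g x))) (φ.1 (Node.map f g e₀)) := by
    intro φ
    have : φ.1 (.under k) = signed (D'.positive k) (Rack.act' (φ.1 (.over k)))
      (φ.1 (D'.next.symm (.under k))) := φ.2 (.under k)
    rw [hφo φ, hunder] at this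
    split_ifs at this with hx
    · rw [hφo φ, hx] at this
      rw [hx, this]
    · exact this
  have hφp : ∀ φ : D'.Coloring X, ∀ z, (∀ i, z ≠ .inf i) →
      φ.1 (D'.next.symm (Node.map f g z)) = φ.1 (Node.map f g (D.next.symm z)) := by
    intro φ z hz
    rw [hprev z hz]
    split_ifs with hx
    · rw [hx, hφo φ]
    · rfl
  obtain ⟨e, he⟩ := h.exists_equiv hφp (fun φ => by
    let ψ : D'.Nodes → X
      | .under _ => signed (D'.positive k) (Rack.act' (φ.1 x)) (φ.1 e₀)
      | _ => φ.1 x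
    have hφ := fun z => h.map_injective.extend_apply φ.1 ψ z
    have hψ : ∀ w, w ∉ Set.range (Node.map (n := 1) f g) → _ :=
      fun w hw => Function.extend_apply' φ.1 ψ w hw
    have ho : _ = φ.1 x := hψ (.over k) (fun hw => hk (over_mem_range_map.1 hw))
    have hu : _ = signed _ (Rack.act' (φ.1 x)) (φ.1 e₀) :=
      hψ (.under k) (fun hw => hk (under_mem_range_map.1 hw))
    set φ' := Function.extend (Node.map f g) φ.1 ψ
    refine ⟨φ', hφ, fun z hz => ?_, fun w hw => ?_⟩
    · rw [hprev z hz]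
      split_ifs with hx
      · rw [hφ, hx, ho]
      · rfl
    · rcases hnew w hw with rfl | rfl
      · change φ' _ = φ' _
        rw [ho, hover, hφ]
      · change φ' _ = signed _ (Rack.act' (φ' _)) (φ' _)
        rw [ho, hu, hunder]
        split_ifs with hx
        · rw [ho, hx]
        · rw [hφ]) (fun φ ψ hφψ w hw => by
    rcases hnew w hw with rfl | rfl
    · rw [hφo, hφo, hφψ]
    · rw [hφu, hφu, hφψ, hφψ])
  refine ⟨e, fun φ => ?_⟩
  have hleg : (e φ).leg = φ.leg := congrFun (he φ) (.inf 0)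
  have hhead : (e φ).head = φ.1 (Node.map f g e₀) := congrFun (he φ) e₀
  have hhead' : φ.head = φ.1 (.under k) := congrArg φ.1 hinf
  obtain ⟨y, hy⟩ := D.exists_par Rack.act' (e φ).1 (e φ).leg
  rw [(e φ).closes_iff_of_par hy]
  rw [he φ] at hy
  -- The old transport ignores the new passage over `k`. In the cover this is harmless: the region
  -- of the head wraps around the tip and joins both ends of that passage on the same sheet
  -- (`coverRel_around_head`).
  have hcover := h.par_map (hφp φ)
    (S := fun p q => D'.CoverRel Rack.act' φ.1 ((p.1, true), p.2) ((q.1, true), q.2))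
    (fun _ => (D'.CoverRel _ _).refl _) (fun h h' => (D'.CoverRel _ _).trans h h')
    (fun h => h.coverRel _ φ.2) (fun z hz y => by
      rw [hprev z hz]
      split_ifs with hx
      · rw [hx, ← hover]
        exact D'.coverRel_around_head φ hnext _ y
      · exact (D'.CoverRel _ _).refl _) hy
  rw [hleg] at hcover
  change D'.CoverRel Rack.act' φ.1 ((.inf 0, true), φ.leg) ((Node.map f g e₀, true), y) at hcover
  -- When `x` is the last edge, the new crossing is a kink, which alters neither the head's colour
  -- nor the transported colour.
  by_cases hx : x = e₀
  · have h1 := par_single (φ := φ.1) ((Equiv.symm_apply_eq _).1 hover).symm (by simp) y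
    rw [if_pos hx] at hunder
    have h2 := h1.trans (par_single ((Equiv.symm_apply_eq _).1 hunder).symm (by simp) _)
    have hu := hφu φ
    rw [hx, signed_act_self] at hu
    rw [(D'.transport_over_under (hφo φ) (by rw [hu, hx]) (by rw [hunder, hφo]) y).1, hx] at h2
    have h3 := D'.coverRel_head Rack.act' φ.1 0 y
    rw [hinf] at h3
    rw [φ.closes_iff ((D'.CoverRel _ _).trans hcover
      ((D'.CoverRel _ _).trans (Par.coverRel _ φ.2 h2) h3)), hhead', hu, hhead]
  -- Otherwise the new under-passage applies one and the same permutation to the head's colour and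
  -- to the transported colour, so their equality is unaffected.
  · rw [if_neg hx] at hunder
    have h2 := par_single (φ := φ.1) ((Equiv.symm_apply_eq _).1 hunder).symm (by simp) y
    have h3 := D'.coverRel_head Rack.act' φ.1 0 (D'.transport Rack.act' φ.1 (.under k) y)
    rw [hinf] at h3
    rw [φ.closes_iff ((D'.CoverRel _ _).trans hcover
      ((D'.CoverRel _ _).trans (h2.coverRel _ φ.2) h3)), hhead', hφu φ, hhead]
    simp only [transport, hφo φ]
    exact (Equiv.injective _).eq_iff.symm

theorem card_closes_of_underMoves [Finite X] {D D' : Diagram 1}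
    (h : Relation.ReflTransGen UnderMove D D') :
    Nat.card {φ : D.Coloring X // φ.Closes} = Nat.card {φ : D'.Coloring X // φ.Closes} := by
  induction h with
  | refl => rfl
  | tail _ h ih =>
    obtain ⟨e, he⟩ := h.exists_equiv (X := X)
    exact ih.trans (Nat.card_congr (e.subtypeEquiv fun φ => (he φ).symm)).symm

/-- The glued endpoints become an auxiliary point, whose colouring condition is precisely that leg
and head agree. -/
theorem IsJoin.card_coloring {D : Diagram 1} {K : Diagram 0} (h : D.IsJoin K) :
    Nat.card (K.Coloring X) = Nat.card {φ : D.Coloring X // φ.leg = φ.head} := by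
  obtain ⟨-, f, g, p, hf, hg, hp, hpos, hnext⟩ := h
  have hpg : ∀ m, g m ≠ p := fun m hm => by
    have : g m ∈ ({p}ᶜ : Set K.Point) := hp ▸ ⟨m, rfl⟩
    exact this hm
  have hbij : Function.Bijective (closeNode f g p) := by
    constructor
    · rintro (c | c | m | i) (c' | c' | m' | i') h <;>
      simp only [closeNode, Node.over.injEq, Node.under.injEq, Node.pt.injEq, reduceCtorEq] at h ⊢
      · exact hf.1 h
      · exact hf.1 h
      · exact hg h
      · exact absurd h (hpg m)
      · exact absurd h.symm (hpg m')
      · exact congrArg Node.inf (Subsingleton.elim _ _)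
    · rintro (k | k | m | i)
      · exact (hf.2 k).elim fun c hc => ⟨.over c, congrArg Node.over hc⟩
      · exact (hf.2 k).elim fun c hc => ⟨.under c, congrArg Node.under hc⟩
      · by_cases hm : m = p
        · exact ⟨.inf 0, congrArg Node.pt hm.symm⟩
        · have : m ∈ Set.range g := hp ▸ hm
          exact this.elim fun c hc => ⟨.pt c, congrArg Node.pt hc⟩
      · exact i.elim0
  have hprev : ∀ x, K.next.symm (closeNode f g p x) = closeNode f g p (D.next.symm x) := by
    intro x
    rw [Equiv.symm_apply_eq, hnext, Equiv.apply_symm_apply]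
  have hcol : ∀ (φ : K.Nodes → X) z, (∀ i, z ≠ .inf i) → (K.ColorsAt φ (closeNode f g p z) ↔
      D.ColorsAt (fun x => φ (closeNode f g p x)) z) := by
    intro φ z hz
    have h1 := hprev z
    rcases z with c | c | m | i
    · simp only [closeNode] at h1
      simp only [ColorsAt, closeNode, h1]
    · simp only [closeNode] at h1
      simp only [ColorsAt, closeNode, h1, hpos]
    · simp only [closeNode] at h1
      simp only [ColorsAt, closeNode, h1]
    · exact absurd rfl (hz i)
  have hinf : ∀ φ : K.Nodes → X, K.ColorsAt φ (closeNode f g p (.inf 0)) ↔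
      φ (closeNode f g p (.inf 0)) = φ (closeNode f g p (D.next.symm (.inf 0))) := by
    intro φ
    rw [← hprev]
    rfl
  let E : D.Nodes ≃ K.Nodes := Equiv.ofBijective _ hbij
  let F : K.Coloring X ≃ {φ : D.Nodes → X // (∀ z, D.ColorsAt φ z) ∧
      φ (.inf 0) = φ (D.next.symm (.inf 0))} :=
    (Equiv.arrowCongr E.symm (Equiv.refl X)).subtypeEquiv fun φ => by
      change (∀ z, K.ColorsAt φ z) ↔ (∀ z, D.ColorsAt (fun x => φ (closeNode f g p x)) z) ∧
        φ (closeNode f g p (.inf 0)) = φ (closeNode f g p (D.next.symm (.inf 0)))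
      constructor
      · intro h
        refine ⟨fun z => ?_, (hinf φ).1 (h _)⟩
        rcases z with c | c | m | i
        · exact (hcol φ _ (by simp)).1 (h _)
        · exact (hcol φ _ (by simp)).1 (h _)
        · exact (hcol φ _ (by simp)).1 (h _)
        · trivial
      · rintro ⟨h, h'⟩ w
        obtain ⟨z, rfl⟩ := hbij.2 w
        rcases z with c | c | m | i
        · exact (hcol φ _ (by simp)).2 (h _)
        · exact (hcol φ _ (by simp)).2 (h _)
        · exact (hcol φ _ (by simp)).2 (h _)
        · rw [Subsingleton.elim i 0]
          exact (hinf φ).2 h'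
  exact Nat.card_congr (F.trans (Equiv.subtypeSubtypeEquivSubtypeInter _ _).symm)

/-- Closing means equal endpoint colours both in the diagram to be joined and in the link-type
diagram `D₀`. Between the two the count of closing colourings is invariant, and from `D₀` back to
`D` the endpoint colours are preserved. -/
theorem IsUnderClosure.card_coloring [Finite X] {D : Diagram 1} (hD : D.IsLinkType) {K : Diagram 0}
    (hK : D.IsUnderClosure K) :
    Nat.card (K.Coloring X) = Nat.card {φ : D.Coloring X // φ.leg = φ.head} := by
  obtain ⟨D₀, h₀, hD₀⟩ := hD
  obtain ⟨D₁, D₂, K₁, h₁, h₂, hJ, hK⟩ := hK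
  obtain ⟨e₀, he₀⟩ := h₀.sameColorings (X := X)
  obtain ⟨e₁, he₁⟩ := h₁.sameColorings (X := X)
  rw [← hK.card_coloring, hJ.card_coloring,
    Nat.card_congr (Equiv.subtypeEquivRight fun φ => (hJ.1.closes_iff φ).symm),
    ← card_closes_of_underMoves h₂]
  refine Nat.card_congr (e₁.subtypeEquiv fun φ => ?_).symm
  rw [(he₁ φ).2.2, ← (he₀ φ).2.2, hD₀.closes_iff, (he₀ φ).1, (he₀ φ).2.1]

/-- In a diagram with endpoints in one region leg and head act alike, and faithfulness identifies
them; Reidemeister moves preserve both colours. -/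
theorem IsLinkType.leg_eq_head [Finite X] {D : Diagram 1} (hD : D.IsLinkType) (hX : IsFaithful X)
    (φ : D.Coloring X) : φ.leg = φ.head := by
  obtain ⟨D₀, h₀, hD₀⟩ := hD
  obtain ⟨e, he⟩ := h₀.sameColorings (X := X)
  rw [← (he φ).1, ← (he φ).2.1]
  exact hX (hD₀.act_eq _)

end Closure

end Diagram

end Linkoid

theorem mainTheorem8 {X : Type*} [Quandle X] [Fintype X] (D : Linkoid.Diagram 1)
    (hD : D.IsLinkType) (K : Linkoid.Diagram 0) (hK : D.IsUnderClosure K) :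
    (D.countingMatrix X).trace = K.quandleCount X ∧
    (Linkoid.IsFaithful X → ∀ i j : X, i ≠ j → D.countingMatrix X i j = 0) ∧
    (Linkoid.IsFaithful X → D.quandleCount X = K.quandleCount X) := by
  refine ⟨?_, fun hX i j hij => ?_, fun hX => ?_⟩
  · rw [D.trace_countingMatrix, K.quandleCount_eq, hK.card_coloring hD]
  · rw [D.countingMatrix_apply]
    have : IsEmpty {φ : D.Coloring X // φ.leg = i ∧ φ.head = j} :=
      ⟨fun φ => hij (φ.2.1.symm.trans ((hD.leg_eq_head hX φ.1).trans φ.2.2))⟩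
    exact Nat.card_of_isEmpty
  · rw [D.quandleCount_eq, K.quandleCount_eq, hK.card_coloring hD]
    exact (Nat.card_congr (Equiv.subtypeUnivEquiv fun φ => hD.leg_eq_head hX φ)).symm
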